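/- Write $s=q^{1/2}$, $v=t^{1/2}$, $[k]=q^{-k/2}-q^{k/2}$ and $\Lambda=\mathbb{Q}[s^{\pm1},[k]^{-1}:k\ge 1]$. For a diagram $D$ of an oriented link let $\mathcal{H}(D)\in\Lambda[v^{\pm1}]$ be its framed HOMFLY polynomial (with the blackboard framing), that is, the unique function of link diagrams that is invariant under planar isotopy and the Reidemeister moves II and III and satisfies $\mathcal{H}(D_+)-\mathcal{H}(D_-)=[1]\,\mathcal{H}(D_0)$, is multiplied by $t^{\mp 1/2}$ when a positive (negative) curl is inserted and by $(t^{-1/2}-t^{1/2})/(q^{-1/2}-q^{1/2})$ when a disjoint circle is added, and is $1$ on the empty diagram. For a diagram $\mathcal{L}$ of an oriented link with components $1,\dots,L$ and Young diagrams $\vec A=(A^1,\dots,A^L)$, the quantum $\mathfrak{sl}_N$ invariant $W_{\vec A}(\mathcal{L};s,v)\in\Lambda[v^{\pm1}]$ is the framed HOMFLY polynomial of $\mathcal{L}$ with its component $\alpha$ decorated by the closure, in the annulus, of the idempotent $E_{A^\alpha}$ (the $q$-analogue of the normalized Young symmetrizer of $A^\alpha$) of the Hecke algebra on $|A^\alpha|$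 strands. Put $|\vec A|=\sum_\alpha|A^\alpha|$, let $\vec A^{\,t}$ be the tuple of the transposed diagrams, and let $$Z_{\vec\mu}(\mathcal{L})=\sum_{\vec A}\Big(\prod_{\alpha=1}^{L}\chi_{A^\alpha}(C_{\mu^\alpha})\Big)W_{\vec A}(\mathcal{L}),$$ where $\chi_A$ is the irreducible character of the symmetric group labelled by $A$ and $C_\mu$ is the class of cycle type $\mu$. Then: 1. For every link diagram $D$, the degrees in $t$ of $\mathcal{H}(D)$ are either all integers or all half-integers: $\mathcal{H}(D)\in\Lambda[t^{\pm1}]$ or $\mathcal{H}(D)\in t^{1/2}\Lambda[t^{\pm1}]$. 2. For every $\mathcal{L}$ and $\vec A$: $\;W_{\vec A^{\,t}}(\mathcal{L};s^{-1},v)=(-1)^{|\vec A|}\,W_{\vec A}(\mathcal{L};s,v)$. 3. If every component of $\mathcal{L}$ has framing $0$ (its self-writhe in the diagram is $0$), then for all $\vec A$ and $\vec\mu$ $$W_{\vec A}(\mathcal{L};s,-v)=(-1)^{|\vec A|}\,W_{\vec A}(\mathcal{L};s,v),\qquad t^{-|\vec\mu|/2}\,Z_{\vec\mu}(\mathcal{L})\in\Lambda[t^{\pm1}],$$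 and consequently $W_{\vec A^{\,t}}(\mathcal{L};s^{-1},-v)=W_{\vec A}(\mathcal{L};s,v)$. -/

import Mathlib

open scoped LaurentPolynomial

namespace Homfly

/-- The denominators allowed in the coefficient ring: products of powers of `s` and of the
elements `s ^ (2 * k) - 1 = - s ^ k * [k]` for `k ≥ 1`, where `[k] = s ^ (-k) - s ^ k`. -/
noncomputable def denominators : Submonoid (Polynomial ℚ) :=
  Submonoid.closure
    ({Polynomial.X} ∪ Set.range fun k : ℕ => Polynomial.X ^ (2 * (k + 1)) - 1)

/-- The ring `ℚ[s^{±1}, [k]⁻¹ : k ≥ 1]`, with `s = q^{1/2}`. -/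
def Coeff : Type := Localization denominators

noncomputable instance : CommRing Coeff := inferInstanceAs (CommRing (Localization denominators))

noncomputable instance : Algebra (Polynomial ℚ) Coeff :=
  inferInstanceAs (Algebra (Polynomial ℚ) (Localization denominators))

noncomputable instance : Algebra ℚ Coeff :=
  inferInstanceAs (Algebra ℚ (Localization denominators))

instance : IsScalarTower ℚ (Polynomial ℚ) Coeff :=
  inferInstanceAs (IsScalarTower ℚ (Polynomial ℚ) (Localization denominators))

instance : IsLocalization denominators Coeff :=
  inferInstanceAs (IsLocalization denominators (Localization denominators))

theorem isUnit_of_mem {p : Polynomial ℚ} (hp : p ∈ denominators) :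
    IsUnit (algebraMap (Polynomial ℚ) Coeff p) :=
  IsLocalization.map_units Coeff (⟨p, hp⟩ : denominators)

/-- The unit `s = q^{1/2}`. -/
noncomputable def s : Coeffˣ :=
  (isUnit_of_mem (Submonoid.subset_closure (Or.inl rfl))).unit

/-- `[k] = q^{-k/2} - q^{k/2}`. -/
noncomputable def bracket (k : ℕ) : Coeff :=
  ((s ^ (-(k : ℤ)) : Coeffˣ) : Coeff) - ((s ^ (k : ℤ) : Coeffˣ) : Coeff)

/-- The ring `ℚ[s^{±1}, v^{±1}, [k]⁻¹ : k ≥ 1]`: Laurent polynomials in `v = t^{1/2}`. -/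
abbrev Scalars : Type := Coeff[T;T⁻¹]

/-- The power `v ^ n`, where `v = t^{1/2}`. -/
noncomputable def v (n : ℤ) : Scalars := LaurentPolynomial.T n

theorem isUnit_invert (y : denominators) :
    IsUnit ((Polynomial.aeval ((s⁻¹ : Coeffˣ) : Coeff) : Polynomial ℚ →ₐ[ℚ] Coeff).toRingHom
      (y : Polynomial ℚ)) := by
  obtain ⟨p, hp⟩ := y
  have hs : algebraMap (Polynomial ℚ) Coeff Polynomial.X = (s : Coeff) := rfl
  induction hp using Submonoid.closure_induction with
  | one => simp
  | mul a b _ _ ha hb =>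
    simp only [map_mul] at ha hb ⊢
    exact ha.mul hb
  | mem a ha =>
    rcases ha with ha | ⟨k, rfl⟩
    · rw [Set.mem_singleton_iff] at ha
      subst ha
      simp
    · have h : IsUnit ((s : Coeff) ^ (2 * (k + 1)) - 1) := by
        have := isUnit_of_mem
          (Submonoid.subset_closure (Or.inr ⟨k, rfl⟩) :
            (Polynomial.X ^ (2 * (k + 1)) - 1 : Polynomial ℚ) ∈ denominators)
        simpa [hs] using this
      have e : ((s⁻¹ : Coeffˣ) : Coeff) ^ (2 * (k + 1)) - 1
          = -(((s⁻¹ : Coeffˣ) : Coeff) ^ (2 * (k + 1)) * ((s : Coeff) ^ (2 * (k + 1)) - 1)) := by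
        rw [mul_sub, ← mul_pow, Units.inv_mul]
        ring
      have h2 : IsUnit (((s⁻¹ : Coeffˣ) : Coeff) ^ (2 * (k + 1))) := (Units.isUnit _).pow _
      have h3 := (h2.mul h).neg
      rw [← e] at h3
      simpa using h3

/-- The substitution `s ↦ s⁻¹` on coefficients. -/
noncomputable def invertCoeff : Coeff →+* Coeff :=
  IsLocalization.lift (M := denominators) isUnit_invert

/-- `v` as a unit. -/
noncomputable def vUnit : Scalarsˣ where
  val := v 1
  inv := v (-1)
  val_inv := by rw [v, v, ← LaurentPolynomial.T_add]; rfl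
  inv_val := by rw [v, v, ← LaurentPolynomial.T_add]; rfl

/-- The substitution `(s, v) ↦ (s⁻¹, v)`. -/
noncomputable def substInvS : Scalars →+* Scalars :=
  LaurentPolynomial.eval₂ (LaurentPolynomial.C.comp invertCoeff) vUnit

/-- The substitution `(s, v) ↦ (s, -v)`. -/
noncomputable def substNegV : Scalars →+* Scalars :=
  LaurentPolynomial.eval₂ LaurentPolynomial.C (-vUnit)

/-- The inclusion of `ℚ[s^{±1}, [k]⁻¹][t^{±1}]` into the scalars, given by `t = v ^ 2`. -/
noncomputable def inclT : Coeff[T;T⁻¹] →+* Scalars :=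
  LaurentPolynomial.eval₂ LaurentPolynomial.C (vUnit ^ 2)

/-- Elementary pieces of an oriented planar diagram whose strands carry labels in `ι`, read from
bottom to top. `birth c o` is a local minimum of a strand labelled `c` whose left leg is oriented
upwards if `o = true` and downwards if `o = false`; `death` is a local maximum; `cross b` is a
crossing of two neighbouring strands, in which the strand going from bottom left to top right
is the upper one if `b = true` and the lower one if `b = false`. -/
inductive Piece (ι : Type) : Type where
  | birth (c : ι) (o : Bool) : Piece ι
  | death : Piece ι
  | cross (b : Bool) : Piece ι

/-- A planar diagram in general position with respect to the height function, as the list of its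
elementary pieces from bottom to top. Each piece comes with the number of strands to its left. -/
abbrev Word (ι : Type) : Type := List (ℕ × Piece ι)

/-- The labels and orientations (`true` is upwards) of the strands met by a horizontal line,
from left to right. -/
abbrev Level (ι : Type) : Type := List (ι × Bool)

namespace Piece

/-- The number of strands that enter from below. -/
def inputs {ι : Type} : Piece ι → ℕ
  | birth _ _ => 0
  | death => 2
  | cross _ => 2

/-- The number of strands that leave at the top. -/
def outputs {ι : Type} : Piece ι → ℕ
  | birth _ _ => 2
  | death => 0
  | cross _ => 2

/-- Change of labels. -/
def map {ι κ : Type} (f : ι → κ) : Piece ι → Piece κ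
  | birth c o => birth (f c) o
  | death => death
  | cross b => cross b

end Piece

/-- The level above a piece, if the piece fits on top of the given level: at a local maximum
two neighbouring strands with the same label and opposite orientations have to meet. -/
def step {ι : Type} [DecidableEq ι] (S : Level ι) : ℕ × Piece ι → Option (Level ι)
  | (i, .birth c o) =>
    if i ≤ S.length then some (S.take i ++ (c, o) :: (c, !o) :: S.drop i) else none
  | (i, .death) =>
    match S.drop i with
    | a :: b :: r => if a.1 = b.1 ∧ a.2 = !b.2 then some (S.take i ++ r) else none
    | _ => none
  | (i, .cross _) =>
    match S.drop i with
    | a :: b :: r => some (S.take i ++ b :: a :: r)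
    | _ => none

/-- The level above a diagram that starts from a given level. -/
def run {ι : Type} [DecidableEq ι] : Level ι → Word ι → Option (Level ι)
  | S, [] => some S
  | S, e :: w => (step S e).bind fun S' => run S' w

/-- The diagram has no end points, so it is a link diagram. -/
def Closed {ι : Type} [DecidableEq ι] (w : Word ι) : Prop := run [] w = some []

/-- Oriented diagrams without labels. -/
abbrev Diagram : Type := Word Unit

/-- Planar isotopies and the Reidemeister moves II and III. -/
inductive Move : Diagram → Diagram → Prop where
  /-- Pieces in disjoint columns may pass each other. -/
  | interchange (i k : ℕ) (g h : Piece Unit) (hik : i ≤ k) :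
      Move [(i, g), (k + g.outputs, h)] [(k + g.inputs, h), (i, g)]
  | zigzag_left (i : ℕ) (o : Bool) : Move [(i + 1, .birth () o), (i, .death)] []
  | zigzag_right (i : ℕ) (o : Bool) : Move [(i, .birth () o), (i + 1, .death)] []
  /-- A strand passes below or above a local minimum. -/
  | slide_birth (i : ℕ) (o b : Bool) :
      Move [(i, .birth () o), (i + 1, .cross b)] [(i + 1, .birth () o), (i, .cross !b)]
  /-- A strand passes below or above a local maximum. -/
  | slide_death (i : ℕ) (b : Bool) :
      Move [(i, .cross b), (i + 1, .death)] [(i + 1, .cross !b), (i, .death)]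
  | reidemeister_two (i : ℕ) (b : Bool) : Move [(i, .cross b), (i, .cross !b)] []
  /-- The hypothesis says that one of the three strands lies above the two others and one of
  them lies below the two others. -/
  | reidemeister_three (i : ℕ) (b₁ b₂ b₃ : Bool) (h : ¬ (b₁ = b₃ ∧ b₂ ≠ b₁)) :
      Move [(i, .cross b₁), (i + 1, .cross b₂), (i, .cross b₃)]
        [(i + 1, .cross b₃), (i, .cross b₂), (i + 1, .cross b₁)]

/-- A strand with a small curl, to the right or to the left. Both strands at the crossing are
directed upwards or both downwards, so the crossing is positive if `b = true` and negative if
`b = false`. -/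
inductive Curl : Bool → Diagram → Prop where
  | right (i : ℕ) (o b : Bool) :
      Curl b [(i + 1, .birth () o), (i, .cross b), (i + 1, .death)]
  | left (i : ℕ) (o b : Bool) :
      Curl b [(i, .birth () o), (i + 1, .cross b), (i, .death)]

/-- The two strands at positions `i` and `i + 1` above the diagram `x` are both directed upwards
or both directed downwards. -/
def ParallelAt (x : Diagram) (i : ℕ) : Prop :=
  ∃ (S S' : Level Unit) (a b : Unit × Bool),
    run [] x = some (S ++ a :: b :: S') ∧ S.length = i ∧ a.2 = b.2

/-- The defining properties of the framed HOMFLY polynomial of link diagrams, with the blackboard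
framing. It is extended by `0` to lists of pieces that do not form a link diagram. -/
structure IsFramedHomfly (H : Diagram → Scalars) : Prop where
  eq_zero : ∀ x, ¬ Closed x → H x = 0
  empty : H [] = 1
  /-- A disjoint circle gives the factor `(t^{-1/2} - t^{1/2}) / (q^{-1/2} - q^{1/2})`. -/
  circle : ∀ (x y : Diagram) (i : ℕ) (o : Bool),
    Closed (x ++ [(i, .birth () o), (i, .death)] ++ y) →
    LaurentPolynomial.C (bracket 1) * H (x ++ [(i, .birth () o), (i, .death)] ++ y)
      = (v (-1) - v 1) * H (x ++ y)
  move : ∀ x y m m' : Diagram, Move m m' → Closed (x ++ m ++ y) → Closed (x ++ m' ++ y) →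
    H (x ++ m ++ y) = H (x ++ m' ++ y)
  /-- A positive curl gives the factor `t^{-1/2}`, a negative one `t^{1/2}`. -/
  curl : ∀ (x y m : Diagram) (b : Bool), Curl b m → Closed (x ++ m ++ y) →
    H (x ++ m ++ y) = v (if b then -1 else 1) * H (x ++ y)
  /-- Positive crossing minus negative crossing is `[1]` times the oriented smoothing. -/
  skein : ∀ (x y : Diagram) (i : ℕ), ParallelAt x i → Closed (x ++ y) →
    H (x ++ [(i, .cross true)] ++ y) - H (x ++ [(i, .cross false)] ++ y)
      = LaurentPolynomial.C (bracket 1) * H (x ++ y)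

open Classical in
/-- The framed HOMFLY polynomial: the unique function with the properties above (its existence
and uniqueness is the theorem of Freyd, Yetter, Hoste, Lickorish, Millett, Ocneanu, Przytycki
and Traczyk). -/
noncomputable def homfly : Diagram → Scalars :=
  if h : ∃! H : Diagram → Scalars, IsFramedHomfly H then h.choose else 0

/-- A diagram of an oriented link whose components are numbered by `Fin L`: every number occurs,
and all strands with the same number belong to one component. The latter is expressed by saying
that the strands with a given number cannot be divided further in a consistent way: any division
of the strands into two classes that makes sense for a diagram is constant on them. -/
structure Link (L : ℕ) : Type where
  word : Word (Fin L)
  closed : Closed word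
  occurs : ∀ c : Fin L, ∃ i o, (i, Piece.birth c o) ∈ word
  connected : ∀ w : Word (Fin L × Bool), Closed w →
    w.map (Prod.map id (Piece.map Prod.fst)) = word →
    ∀ (c : Fin L) (x y : Bool) (i j : ℕ) (o p : Bool),
      (i, Piece.birth (c, x) o) ∈ w → (j, Piece.birth (c, y) p) ∈ w → x = y

/-- The sum of the signs of the crossings of the component `c` with itself in a diagram that
starts from the level `S`. -/
def selfWritheFrom {ι : Type} [DecidableEq ι] (c : ι) : Level ι → Word ι → ℤ
  | _, [] => 0
  | S, e :: w =>
    (match e, S.drop e.1 with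
      | (_, .cross u), a :: b :: _ =>
        if a.1 = c ∧ b.1 = c then (if u = (a.2 == b.2) then 1 else -1) else 0
      | _, _ => 0) + selfWritheFrom c ((step S e).getD []) w

/-- The blackboard framing of the diagram is the framing `0` on each component. -/
def Link.ZeroFramed {L : ℕ} (K : Link L) : Prop :=
  ∀ c, selfWritheFrom c [] K.word = 0

/-- Replaces each strand labelled `c` by `m c` parallel strands, in a diagram that starts from
the level `S`. At the first local minimum of each label that is not in `done`, the positive braid
`p c` on `m c` upward strands is inserted; the entry `k` of the list `p c` stands for the
positive crossing of the strands at the positions `k` and `k + 1`. -/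
def satelliteFrom {ι : Type} [DecidableEq ι] (m : ι → ℕ) (p : ι → List ℕ) :
    List ι → Level ι → Word ι → Diagram
  | _, _, [] => []
  | done, S, e :: w =>
    let width : ℕ → ℕ := fun k => ((S[k]?).map fun a => m a.1).getD 0
    let off : ℕ := ((List.range e.1).map width).sum
    let rest : List ι → Diagram := fun d => satelliteFrom m p d ((step S e).getD []) w
    match e.2 with
    | .birth c o =>
      (List.range (m c)).map (fun k => (off + k, Piece.birth () o))
        ++ (if c ∈ done then [] else
            (p c).map fun k => ((if o then off else off + m c) + k, Piece.cross true))
        ++ rest (c :: done)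
    | .death =>
      (List.range (width e.1)).reverse.map (fun k => (off + k, Piece.death)) ++ rest done
    | .cross b =>
      (List.range (width e.1)).reverse.flatMap
          (fun k => (List.range (width (e.1 + 1))).map fun j => (off + k + j, Piece.cross b))
        ++ rest done

/-- The diagram of the link whose component `c` is decorated, in the annulus given by the
blackboard framing, by the closure of the positive braid `p c` on `m c` strands. -/
def Link.satellite {L : ℕ} (K : Link L) (m : Fin L → ℕ) (p : Fin L → List ℕ) : Diagram :=
  satelliteFrom m p [] [] K.word

/-- The positive permutation braid that moves the strand at position `r` to the position of the
`r`-th entry of the list in its increasing rearrangement. For a list without repetitions this is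
a reduced word of that permutation. -/
def sortWord : List ℕ → List ℕ
  | [] => []
  | x :: l => (sortWord l).map (· + 1) ++ List.range (l.countP (· < x))

/-- The positive permutation braid of a permutation. -/
def permWord {n : ℕ} (π : Equiv.Perm (Fin n)) : List ℕ :=
  sortWord (List.ofFn fun i => (π i : ℕ))

/-- The number of the block that contains `i`, where the natural numbers are divided from `0` on
into consecutive blocks of the given sizes. -/
def blockIndex : List ℕ → ℕ → ℕ
  | [], _ => 0
  | b :: l, i => if i < b then 0 else blockIndex l (i - b) + 1

/-- The Young subgroup of the permutations that preserve each of the consecutive blocks. -/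
def youngSubgroup (blocks : List ℕ) (n : ℕ) : Finset (Equiv.Perm (Fin n)) :=
  Finset.univ.filter fun π => ∀ i, blockIndex blocks (π i) = blockIndex blocks i

/-- The positive permutation braid from the row reading to the column reading of the cells. -/
def readingWord (A : YoungDiagram) : List ℕ :=
  sortWord <| (List.range A.rowLens.length).flatMap fun i =>
    (List.range (A.rowLen i)).map fun j => ((List.range j).map A.colLen).sum + i

/-- `∏ s^{-cn(c)} [hl(c)] / [1]` over the cells `c`, with content `cn` and hook length `hl`. -/
noncomputable def hookProduct (A : YoungDiagram) : Coeff :=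
  ∏ c ∈ A.cells, ((s ^ ((c.1 : ℤ) - (c.2 : ℤ)) : Coeffˣ) : Coeff) *
    (bracket ((A.rowLen c.1 - c.2) + (A.colLen c.2 - c.1) - 1) * Ring.inverse (bracket 1))

/-- The idempotent `E_A` of the Hecke algebra, as a linear combination of positive braid words:
the `q`-analogue `hookProduct⁻¹ • (∑ s^{-ℓ(π)} T_π) T_w (∑ (-s)^{ℓ(ρ)} T_ρ) T_{w⁻¹}` of the Young
symmetrizer, in which `π` permutes the rows in the row reading of `A`, `ρ` permutes the columns in
the column reading, and `w` leads from the former to the latter. The generators satisfy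
`T - T⁻¹ = s⁻¹ - s`. -/
noncomputable def youngIdempotent (A : YoungDiagram) : List ℕ →₀ Coeff :=
  ∑ π ∈ youngSubgroup A.rowLens A.card, ∑ ρ ∈ youngSubgroup A.transpose.rowLens A.card,
    Finsupp.single (permWord π ++ readingWord A ++ permWord ρ ++ (readingWord A).reverse)
      (Ring.inverse (hookProduct A) *
        ((s ^ (-((permWord π).length : ℤ)) : Coeffˣ) : Coeff) *
        (-(s : Coeff)) ^ (permWord ρ).length)

/-- The quantum `sl_N` invariant `W_A`: the framed HOMFLY polynomial of the link whose component
`c` is decorated by the closure of `E_{A c}`, for all `c`. It is linear in each decoration. -/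
noncomputable def quantumInvariant {L : ℕ} (K : Link L) (A : Fin L → YoungDiagram) : Scalars :=
  ∑ p ∈ Fintype.piFinset fun c => (youngIdempotent (A c)).support,
    LaurentPolynomial.C (∏ c, youngIdempotent (A c) (p c)) *
      homfly (K.satellite (fun c => (A c).card) p)

/-- The Young symmetrizer `∑ sign(ρ) π ρ` in the group algebra of the permutations of the cells,
where `π` preserves the rows and `ρ` preserves the columns. -/
noncomputable def youngSymmetrizer (A : YoungDiagram) :
    MonoidAlgebra ℚ (Equiv.Perm A.cells) :=
  (∑ π : Equiv.Perm A.cells with ∀ c, (π c).1.1 = c.1.1, MonoidAlgebra.of ℚ _ π) *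
    ∑ ρ : Equiv.Perm A.cells with ∀ c, (ρ c).1.2 = c.1.2,
      ((Equiv.Perm.sign ρ : ℤ) : ℚ) • MonoidAlgebra.of ℚ _ ρ

/-- The Specht module of `A`: the left ideal generated by the Young symmetrizer. -/
noncomputable abbrev spechtModule (A : YoungDiagram) :
    Ideal (MonoidAlgebra ℚ (Equiv.Perm A.cells)) :=
  Ideal.span {youngSymmetrizer A}

open Classical in
/-- The value `χ_A(C_μ)` of the irreducible character of the symmetric group labelled by `A` at
the permutations of cycle type `μ`; it is `0` if `|A| ≠ |μ|`. -/
noncomputable def character (A μ : YoungDiagram) : ℚ :=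
  if h : ∃ g : Equiv.Perm A.cells, g.partition.parts = (μ.rowLens : Multiset ℕ) then
    LinearMap.trace ℚ (spechtModule A)
      (Algebra.lsmul ℚ ℚ (spechtModule A) (MonoidAlgebra.of ℚ _ h.choose))
  else 0

/-- `Z_μ = ∑_A χ_A(C_μ) W_A`; the sum is finite, because `χ_A(C_μ) = 0` unless `|A c| = |μ c|` for
all `c`. -/
noncomputable def reformulatedInvariant {L : ℕ} (K : Link L) (μ : Fin L → YoungDiagram) :
    Scalars :=
  ∑ᶠ A : Fin L → YoungDiagram,
    algebraMap ℚ Scalars (∏ c, character (A c) (μ c)) * quantumInvariant K A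

end Homfly

namespace Homfly

/-! Both symmetries come from uniqueness of the HOMFLY polynomial. Let `weight 1 κ` be the total
turning number of a diagram plus `κ` times its number of crossings, modulo 2. It is unchanged by
planar isotopy and by the moves II and III; a circle adds 1, a curl adds `κ + 1`, and a crossing of
parallel strands exceeds its smoothing by `κ`. If a ring endomorphism φ multiplies [1] by `(-1)^κ`
and `v^{±1}` by `(-1)^(κ+1)`, then `D ↦ (-1)^weight · φ(H(D))` satisfies all defining relations
again, hence equals `H` (`IsFramedHomfly.twist`). The case `κ = 1` is `s ↦ s⁻¹`, the case `κ = 0` is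
`v ↦ -v`; the latter gives the statement on degrees in `t` at once. If existence or uniqueness
fails, `homfly` is 0 by definition and the claims are trivial, so the HOMFLY theorem itself is not
needed.

For a satellite, the weight is that of the original diagram with multiplicities `m c`, plus `κ`
times the lengths of the inserted braids (`runs_satelliteFrom`). Whitney's formula modulo 2
(`Link.weight_word`) evaluates the first part as `∑ m c` for `κ = 1`. Framing 0 makes the number of
self-crossings of each component even, so the same value holds for `κ = 0`
(`Link.ZeroFramed.weight_word`).

It remains to compare the idempotents of a diagram and of its transpose. Inverting `s` and inserting
the signs of the braid lengths exchanges their coefficients (`invertCoeff_youngCoeffTranspose`). The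
braid words agree after two changes: the reading braid of the transpose is the reverse of the
original one (`braidEq_readingWord`), and the factors are rotated cyclically
(`Link.satellite_rotate_all`). Rotation is legitimate because a crossing can be carried along the
cable around its component; a parity argument (`even_countP_markers`) replaces tracing the path. -/

/-- The effect of an elementary piece on the strands that it meets. -/
inductive Piece.Acts {ι : Type} : Piece ι → Level ι → Level ι → Prop where
  | birth (c : ι) (o : Bool) : Piece.Acts (.birth c o) [] [(c, o), (c, !o)]
  | death (c : ι) (o : Bool) : Piece.Acts .death [(c, o), (c, !o)] []
  | cross (b : Bool) (a a' : ι × Bool) : Piece.Acts (.cross b) [a, a'] [a', a]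

/-! ### Levels of a diagram and the weight modulo 2 -/

section Levels

variable {ι : Type}

theorem Piece.Acts.length_inputs {g : Piece ι} {I O : Level ι} (h : g.Acts I O) :
    I.length = g.inputs := by cases h <;> rfl

theorem Piece.Acts.length_outputs {g : Piece ι} {I O : Level ι} (h : g.Acts I O) :
    O.length = g.outputs := by cases h <;> rfl

variable [DecidableEq ι]

theorem step_of_acts {g : Piece ι} {I O : Level ι} (h : g.Acts I O) (A B : Level ι) {i : ℕ}
    (hi : A.length = i) : step (A ++ (I ++ B)) (i, g) = some (A ++ (O ++ B)) := by
  subst hi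
  cases h <;> simp [step]

theorem exists_of_step {S T : Level ι} {i : ℕ} {g : Piece ι} (h : step S (i, g) = some T) :
    ∃ A I O B, S = A ++ (I ++ B) ∧ A.length = i ∧ g.Acts I O ∧ T = A ++ (O ++ B) := by
  cases g with
  | birth c o =>
    simp only [step] at h
    split_ifs at h with hi
    refine ⟨S.take i, [], _, S.drop i, by simp, by simpa using hi, .birth c o, ?_⟩
    simpa using h.symm
  | death =>
    simp only [step] at h
    split at h
    · rename_i a b r hd
      split_ifs at h with hab
      have hl : i ≤ S.length := by
        by_contra hl
        rw [List.drop_eq_nil_of_le (by omega)] at hd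
        simp at hd
      obtain ⟨a1, a2⟩ := a
      obtain ⟨b1, b2⟩ := b
      obtain ⟨rfl, rfl⟩ : a1 = b1 ∧ a2 = !b2 := hab
      refine ⟨S.take i, [(a1, !b2), (a1, b2)], [], r, ?_, by simpa using hl, ?_, ?_⟩
      · conv_lhs => rw [← List.take_append_drop i S, hd]
        simp
      · simpa using Piece.Acts.death a1 (!b2)
      · simpa using h.symm
    · simp at h
  | cross u =>
    simp only [step] at h
    split at h
    · rename_i a b r hd
      have hl : i ≤ S.length := by
        by_contra hl
        rw [List.drop_eq_nil_of_le (by omega)] at hd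
        simp at hd
      refine ⟨S.take i, [a, b], [b, a], r, ?_, by simpa using hl, .cross u a b, ?_⟩
      · conv_lhs => rw [← List.take_append_drop i S, hd]
        simp
      · simpa using h.symm
    · simp at h

theorem run_append (S : Level ι) (w w' : Word ι) :
    run S (w ++ w') = (run S w).bind fun T => run T w' := by
  induction w generalizing S with
  | nil => rfl
  | cons e w ih =>
    simp only [List.cons_append, run]
    cases step S e with
    | none => rfl
    | some T => simp [ih]

theorem run_singleton (S : Level ι) (e : ℕ × Piece ι) : run S [e] = step S e := by
  simp [run]

theorem run_append_eq_some {S T : Level ι} {w w' : Word ι} :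
    run S (w ++ w') = some T ↔ ∃ R, run S w = some R ∧ run R w' = some T := by
  rw [run_append, Option.bind_eq_some_iff]

theorem run_cons_eq_some {S T : Level ι} {e : ℕ × Piece ι} {w : Word ι} :
    run S (e :: w) = some T ↔ ∃ R, step S e = some R ∧ run R w = some T := by
  rw [run, Option.bind_eq_some_iff]

/-- The contribution of a piece on the strands `l` to the total turning number plus `κ` times the
number of crossings, modulo `2`, where the strands labelled `c` count `m c` times. -/
def Piece.weight (m : ι → ZMod 2) (κ : ZMod 2) : Piece ι → Level ι → ZMod 2
  | .birth c o, _ => if o then 0 else m c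
  | .death, a :: _ => if a.2 then m a.1 else 0
  | .cross _, a :: b :: _ => κ * (m a.1 * m b.1)
  | _, _ => 0

/-- The total turning number plus `κ` times the number of crossings, modulo `2`, of a diagram that
starts from the level `S`. -/
def weight (m : ι → ZMod 2) (κ : ZMod 2) : Level ι → Word ι → ZMod 2
  | _, [] => 0
  | S, e :: w => e.2.weight m κ (S.drop e.1) + weight m κ ((step S e).getD []) w

omit [DecidableEq ι] in
theorem Piece.Acts.weight_append {g : Piece ι} {I O : Level ι} (h : g.Acts I O)
    (m : ι → ZMod 2) (κ : ZMod 2) (B : Level ι) : g.weight m κ (I ++ B) = g.weight m κ I := by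
  cases h <;> rfl

theorem weight_append (m : ι → ZMod 2) (κ : ZMod 2) {S T : Level ι} {w : Word ι}
    (h : run S w = some T) (w' : Word ι) :
    weight m κ S (w ++ w') = weight m κ S w + weight m κ T w' := by
  induction w generalizing S with
  | nil =>
    simp only [run, Option.some.injEq] at h
    subst h
    simp [weight]
  | cons e w ih =>
    obtain ⟨R, hR, hw⟩ := run_cons_eq_some.1 h
    simp [weight, hR, ih hw, add_assoc]

theorem weight_cons_of_acts (m : ι → ZMod 2) (κ : ZMod 2) {g : Piece ι} {I O : Level ι}
    (h : g.Acts I O) (A B : Level ι) {i : ℕ} (hi : A.length = i) (w : Word ι) :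
    weight m κ (A ++ (I ++ B)) ((i, g) :: w)
      = g.weight m κ I + weight m κ (A ++ (O ++ B)) w := by
  rw [weight, step_of_acts h A B hi]
  subst hi
  simp [h.weight_append]

theorem run_cons_of_acts {g : Piece ι} {I O : Level ι}
    (h : g.Acts I O) (A B : Level ι) {i : ℕ} (hi : A.length = i) (w : Word ι) :
    run (A ++ (I ++ B)) ((i, g) :: w) = run (A ++ (O ++ B)) w := by
  rw [run, step_of_acts h A B hi]
  rfl

/-- A normal form of the level that is symmetric in the two pieces: their inputs are disjoint blocks
separated by `B`. The same right-hand side serves the opposite order, which makes both the resulting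
levels and the weights comparable. -/
theorem run_interchange_aux {i k : ℕ} {g h : Piece ι} (hik : i ≤ k) {S T : Level ι} :
    run S [(i, g), (k + g.outputs, h)] = some T ↔ ∃ A I O B J P C,
      g.Acts I O ∧ h.Acts J P ∧ A.length = i ∧ (A ++ (I ++ B)).length = k + g.inputs ∧
      S = A ++ (I ++ (B ++ (J ++ C))) ∧ T = A ++ (O ++ (B ++ (P ++ C))) := by
  constructor
  · intro hr
    obtain ⟨R, hR, h2⟩ := run_cons_eq_some.1 hr
    rw [run_singleton] at h2
    obtain ⟨A, I, O, B', rfl, rfl, hg, rfl⟩ := exists_of_step hR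
    obtain ⟨A', J, P, C, he, hl, hh, rfl⟩ := exists_of_step h2
    have hO := hg.length_outputs
    have hI := hg.length_inputs
    rw [← List.append_assoc] at he
    obtain ⟨B, rfl, rfl⟩ | ⟨B, h1, h4⟩ := List.append_eq_append_iff.1 he
    · refine ⟨A, I, O, B, J, P, C, hg, hh, rfl, ?_, rfl, by simp⟩
      simp only [List.length_append] at hl ⊢
      omega
    · have h3 := congrArg List.length h1
      simp only [List.length_append] at h3
      obtain rfl : B = [] := List.length_eq_zero_iff.1 (by omega)
      simp only [List.append_nil, List.nil_append] at h1 h4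
      subst h1 h4
      refine ⟨A, I, O, [], J, P, C, hg, hh, rfl, ?_, by simp, by simp⟩
      simp only [List.length_append, List.append_nil] at hl ⊢
      omega
  · rintro ⟨A, I, O, B, J, P, C, hg, hh, rfl, hl, rfl, rfl⟩
    have hO := hg.length_outputs
    have hI := hg.length_inputs
    rw [run_cons_of_acts hg _ _ rfl]
    have := run_cons_of_acts hh (A ++ (O ++ B)) C (i := k + g.outputs) (by
      simp only [List.length_append] at hl ⊢; omega) []
    simp only [List.append_assoc] at this
    rw [this, run]

theorem run_interchange_aux' {i k : ℕ} {g h : Piece ι} (hik : i ≤ k) {S T : Level ι} :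
    run S [(k + g.inputs, h), (i, g)] = some T ↔ ∃ A I O B J P C,
      g.Acts I O ∧ h.Acts J P ∧ A.length = i ∧ (A ++ (I ++ B)).length = k + g.inputs ∧
      S = A ++ (I ++ (B ++ (J ++ C))) ∧ T = A ++ (O ++ (B ++ (P ++ C))) := by
  constructor
  · intro hr
    obtain ⟨R, hR, h2⟩ := run_cons_eq_some.1 hr
    rw [run_singleton] at h2
    obtain ⟨A', J, P, C, rfl, hl, hh, rfl⟩ := exists_of_step hR
    obtain ⟨A, I, O, B', he, rfl, hg, rfl⟩ := exists_of_step h2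
    have hI := hg.length_inputs
    rw [← List.append_assoc A I B'] at he
    obtain ⟨B, h1, h4⟩ | ⟨B, rfl, rfl⟩ := List.append_eq_append_iff.1 he
    · have h3 := congrArg List.length h1
      simp only [List.length_append] at h3
      obtain rfl : B = [] := List.length_eq_zero_iff.1 (by omega)
      simp only [List.append_nil, List.nil_append] at h1 h4
      subst h1 h4
      refine ⟨A, I, O, [], J, P, C, hg, hh, rfl, ?_, by simp, by simp⟩
      simp only [List.length_append, List.append_nil] at hl ⊢
      omega
    · exact ⟨A, I, O, B, J, P, C, hg, hh, rfl, by simpa using hl, by simp, rfl⟩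
  · rintro ⟨A, I, O, B, J, P, C, hg, hh, rfl, hl, rfl, rfl⟩
    have := run_cons_of_acts hh (A ++ (I ++ B)) C hl [(A.length, g)]
    simp only [List.append_assoc] at this
    rw [this, run_cons_of_acts hg _ _ rfl, run]

theorem run_interchange {i k : ℕ} {g h : Piece ι} (hik : i ≤ k) (S : Level ι) :
    run S [(i, g), (k + g.outputs, h)] = run S [(k + g.inputs, h), (i, g)] := by
  ext T
  rw [run_interchange_aux hik, run_interchange_aux' hik]

end Levels

/-! ### Translating diagrams and reducing to column 0 -/

/-- Moves a diagram to the right by `n` strands. -/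
def shift {ι : Type} (n : ℕ) (w : Word ι) : Word ι := w.map (Prod.map (n + ·) id)

section Shift

variable {ι : Type} [DecidableEq ι]

theorem step_shift (A S : Level ι) (e : ℕ × Piece ι) :
    step (A ++ S) (Prod.map (A.length + ·) id e) = (step S e).map (A ++ ·) := by
  obtain ⟨i, g⟩ := e
  have hd : (A ++ S).drop (A.length + i) = S.drop i := List.drop_length_add_append i
  have ht : (A ++ S).take (A.length + i) = A ++ S.take i := List.take_length_add_append i
  cases g with
  | birth c o =>
    simp only [step, Prod.map, id, hd, ht, List.length_append, Nat.add_le_add_iff_left]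
    split_ifs <;> simp
  | death =>
    simp only [step, Prod.map, id, hd, ht]
    split
    · split_ifs <;> simp
    · simp
  | cross b =>
    simp only [step, Prod.map, id, hd, ht]
    split <;> simp

theorem run_shift (A S : Level ι) (w : Word ι) :
    run (A ++ S) (shift A.length w) = (run S w).map (A ++ ·) := by
  induction w generalizing S with
  | nil => rfl
  | cons e w ih =>
    change (step _ _).bind _ = _
    rw [step_shift, run]
    cases step S e with
    | none => rfl
    | some T => exact ih T

theorem weight_shift (m : ι → ZMod 2) (κ : ZMod 2) (A S T : Level ι) (w : Word ι)
    (h : run S w = some T) :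
    weight m κ (A ++ S) (shift A.length w) = weight m κ S w := by
  induction w generalizing S with
  | nil => rfl
  | cons e w ih =>
    obtain ⟨R, hR, hw⟩ := run_cons_eq_some.1 h
    change Piece.weight m κ _ ((A ++ S).drop (A.length + e.1)) +
      weight m κ ((step (A ++ S) (Prod.map (A.length + ·) id e)).getD []) (shift A.length w) = _
    rw [step_shift, hR, weight, hR]
    simp only [Option.map_some, Option.getD_some, ih R hw]
    simp

theorem run_eq_none_of_lt {S : Level ι} {i : ℕ} (h : S.length < i) (g : Piece ι) (w : Word ι) :
    run S ((i, g) :: w) = none := by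
  rw [run]
  cases hs : step S (i, g) with
  | none => rfl
  | some T =>
    obtain ⟨A, I, O, B, rfl, rfl, -⟩ := exists_of_step hs
    simp at h

omit [DecidableEq ι] in
/-- Facts on diagrams near the column `i` may be checked for `i = 0`. -/
theorem split_induction {P : Level ι → ℕ → Prop} (hlt : ∀ S i, S.length < i → P S i)
    (hsplit : ∀ A S : Level ι, P (A ++ S) A.length) (S : Level ι) (i : ℕ) : P S i := by
  obtain h | h := lt_or_ge S.length i
  · exact hlt S i h
  · have := hsplit (S.take i) (S.drop i)
    rwa [List.take_append_drop, List.length_take, min_eq_left h] at this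

end Shift

/-! ### Behaviour of the weight under the moves, curls and circles -/

/-- Levels do not record which strand is the upper one, so the two crossing types are independent of
each other here. -/
theorem run_slide_birth (S : Level Unit) (i : ℕ) (o b b' : Bool) :
    run S [(i, .birth () o), (i + 1, .cross b)] =
      run S [(i + 1, .birth () o), (i, .cross b')] := by
  induction S, i using split_induction with
  | hlt S i h =>
    rw [run_eq_none_of_lt h, run_eq_none_of_lt (Nat.lt_succ_of_lt h)]
  | hsplit A S =>
    have h1 := run_shift A S [(0, .birth () o), (1, .cross b)]
    have h2 := run_shift A S [(1, .birth () o), (0, .cross b')]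
    refine h1.trans (Eq.trans ?_ h2.symm)
    rcases S with _ | ⟨x, S⟩ <;> simp [run, step]

theorem run_slide_death (S : Level Unit) (i : ℕ) (b b' : Bool) :
    run S [(i, .cross b), (i + 1, .death)] = run S [(i + 1, .cross b'), (i, .death)] := by
  induction S, i using split_induction with
  | hlt S i h =>
    rw [run_eq_none_of_lt h, run_eq_none_of_lt (Nat.lt_succ_of_lt h)]
  | hsplit A S =>
    have h1 := run_shift A S [(0, .cross b), (1, .death)]
    have h2 := run_shift A S [(1, .cross b'), (0, .death)]
    refine h1.trans (Eq.trans ?_ h2.symm)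
    rcases S with _ | ⟨x, _ | ⟨y, _ | ⟨z, S⟩⟩⟩ <;> simp [run, step]

theorem run_reidemeister_three (S : Level Unit) (i : ℕ) (b₁ b₂ b₃ c₁ c₂ c₃ : Bool) :
    run S [(i, .cross b₁), (i + 1, .cross b₂), (i, .cross b₃)] =
      run S [(i + 1, .cross c₁), (i, .cross c₂), (i + 1, .cross c₃)] := by
  induction S, i using split_induction with
  | hlt S i h =>
    rw [run_eq_none_of_lt h, run_eq_none_of_lt (Nat.lt_succ_of_lt h)]
  | hsplit A S =>
    have h1 := run_shift A S [(0, .cross b₁), (1, .cross b₂), (0, .cross b₃)]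
    have h2 := run_shift A S [(1, .cross c₁), (0, .cross c₂), (1, .cross c₃)]
    refine h1.trans (Eq.trans ?_ h2.symm)
    rcases S with _ | ⟨x, _ | ⟨y, _ | ⟨z, S⟩⟩⟩ <;> simp [run, step]

/-- The weight of a short diagram is determined on the strands that it meets. -/
theorem weight_local {κ δ : ZMod 2} {S T : Level Unit} {i : ℕ} {u w : Diagram}
    (h : run S u = some T) (hw : shift i w = u) (hi : i ≤ S.length)
    (h0 : ∀ R R' : Level Unit, run R w = some R' → (R' = R ∧ weight 1 κ R w = δ)) :
    T = S ∧ weight 1 κ S u = δ := by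
  subst hw
  induction S, i using split_induction with
  | hlt S i hl => omega
  | hsplit A S =>
    rw [run_shift, Option.map_eq_some_iff] at h
    obtain ⟨R, hR, rfl⟩ := h
    rw [weight_shift _ _ _ _ _ _ hR]
    obtain ⟨rfl, h⟩ := h0 _ _ hR
    exact ⟨rfl, h⟩

theorem weight_local_eq {κ : ZMod 2} {S T : Level Unit} {i : ℕ} {u u' w w' : Diagram}
    (h : run S u = some T) (h' : run S u' = some T) (hw : shift i w = u) (hw' : shift i w' = u')
    (hi : i ≤ S.length) (h0 : ∀ R R' : Level Unit, run R w = some R' → run R w' = some R' →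
      weight 1 κ R w = weight 1 κ R w') :
    weight 1 κ S u = weight 1 κ S u' := by
  rw [← hw] at h ⊢
  rw [← hw'] at h' ⊢
  induction S, i using split_induction with
  | hlt S i hl => omega
  | hsplit A S =>
    rw [run_shift, Option.map_eq_some_iff] at h h'
    obtain ⟨R, hR, rfl⟩ := h
    obtain ⟨R', hR', h⟩ := h'
    obtain rfl := List.append_cancel_left h
    rw [weight_shift _ _ _ _ _ _ hR, weight_shift _ _ _ _ _ _ hR']
    exact h0 _ _ hR hR'

/-- For the interchange, both orders apply the same pieces to the same strands. All other moves are
local: after translation to column 0 they involve at most three strands, and a case distinction on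
those suffices. In a zigzag, either neither or both of the two extrema run from left to right, which
is 0 modulo 2. -/
theorem Move.weight_eq {κ : ZMod 2} {m m' : Diagram} (hm : Move m m') {S T T' : Level Unit}
    (h : run S m = some T) (h' : run S m' = some T') :
    T = T' ∧ weight 1 κ S m = weight 1 κ S m' := by
  have hd : ∀ x : ZMod 2, x + x = 0 := by decide
  have hlen : ∀ {i g u}, run S ((i, g) :: u) = some T → i ≤ S.length := fun {i g u} hr => by
    by_contra hl
    rw [run_eq_none_of_lt (by omega)] at hr
    simp at hr
  cases hm with
  | interchange i k g p hik =>
    have h2 := run_interchange (g := g) (h := p) hik S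
    rw [h, h'] at h2
    refine ⟨Option.some.inj h2, ?_⟩
    obtain ⟨A, I, O, B, J, P, C, hg, hh, rfl, hl, rfl, rfl⟩ := (run_interchange_aux hik).1 h
    have hO := hg.length_outputs
    have hI := hg.length_inputs
    rw [weight_cons_of_acts _ _ hg _ _ rfl]
    have e1 := weight_cons_of_acts (1 : Unit → ZMod 2) κ hh (A ++ (O ++ B)) C
      (i := k + g.outputs) (by simp only [List.length_append] at hl ⊢; omega) []
    have e2 := weight_cons_of_acts (1 : Unit → ZMod 2) κ hh (A ++ (I ++ B)) C hl [(A.length, g)]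
    simp only [List.append_assoc] at e1 e2
    rw [e1, e2, weight_cons_of_acts _ _ hg _ _ rfl]
    simp only [weight]
    ring
  | zigzag_left i o =>
    obtain rfl : S = T' := by simpa [run] using h'
    refine weight_local h (i := i) (w := [(1, .birth () o), (0, .death)]) rfl
      (by have := hlen h; omega) ?_
    rintro (_ | ⟨⟨⟨⟩, x⟩, R⟩) R'
    · simp [run, step]
    · cases o <;> cases x <;> simp [run, step, weight, Piece.weight, hd, eq_comm]
  | zigzag_right i o =>
    obtain rfl : S = T' := by simpa [run] using h'
    refine weight_local h (i := i) (w := [(0, .birth () o), (1, .death)]) rfl (hlen h) ?_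
    rintro (_ | ⟨⟨⟨⟩, x⟩, R⟩) R'
    · simp [run, step]
    · cases o <;> cases x <;> simp [run, step, weight, Piece.weight, hd, eq_comm]
  | slide_birth i o b =>
    obtain rfl : T = T' := by
      rw [run_slide_birth S i o b (!b), h'] at h
      simpa using h.symm
    refine ⟨rfl, weight_local_eq h h' (i := i) (w := [(0, .birth () o), (1, .cross b)])
      (w' := [(1, .birth () o), (0, .cross !b)]) rfl rfl (hlen h) ?_⟩
    rintro (_ | ⟨⟨⟨⟩, x⟩, R⟩) R'
    · simp [run, step]
    · simp [run, step, weight, Piece.weight]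
  | slide_death i b =>
    obtain rfl : T = T' := by
      rw [run_slide_death S i b (!b), h'] at h
      simpa using h.symm
    refine ⟨rfl, weight_local_eq h h' (i := i) (w := [(0, .cross b), (1, .death)])
      (w' := [(1, .cross !b), (0, .death)]) rfl rfl (hlen h) ?_⟩
    rintro (_ | ⟨x, _ | ⟨y, _ | ⟨z, R⟩⟩⟩) R' <;> simp [run, step, weight, Piece.weight]
  | reidemeister_two i b =>
    obtain rfl : S = T' := by simpa [run] using h'
    refine weight_local h (i := i) (w := [(0, .cross b), (0, .cross !b)]) rfl (hlen h) ?_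
    rintro (_ | ⟨x, _ | ⟨y, R⟩⟩) R' <;> simp [run, step, weight, Piece.weight, hd, eq_comm]
  | reidemeister_three i b₁ b₂ b₃ hb =>
    obtain rfl : T = T' := by
      rw [run_reidemeister_three S i b₁ b₂ b₃ b₃ b₂ b₁, h'] at h
      simpa using h.symm
    refine ⟨rfl, weight_local_eq h h' (i := i)
      (w := [(0, .cross b₁), (1, .cross b₂), (0, .cross b₃)])
      (w' := [(1, .cross b₃), (0, .cross b₂), (1, .cross b₁)]) rfl rfl (hlen h) ?_⟩
    rintro (_ | ⟨x, _ | ⟨y, _ | ⟨z, R⟩⟩⟩) R' <;> simp [run, step, weight, Piece.weight]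

/-- A curl contributes one crossing and changes the turning number by one. -/
theorem Curl.weight_eq {κ : ZMod 2} {m : Diagram} {b : Bool} (hm : Curl b m) {S T : Level Unit}
    (h : run S m = some T) : T = S ∧ weight 1 κ S m = κ + 1 := by
  have hlen : ∀ {i g u}, run S ((i, g) :: u) = some T → i ≤ S.length := fun {i g u} hr => by
    by_contra hl
    rw [run_eq_none_of_lt (by omega)] at hr
    simp at hr
  cases hm with
  | right i o b =>
    refine weight_local h (i := i) (w := [(1, .birth () o), (0, .cross b), (1, .death)]) rfl
      (by have := hlen h; omega) ?_
    rintro (_ | ⟨⟨⟨⟩, x⟩, R⟩) R'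
    · simp [run, step]
    · cases o <;> cases x <;> simp [run, step, weight, Piece.weight, eq_comm, add_comm]
  | left i o b =>
    refine weight_local h (i := i) (w := [(0, .birth () o), (1, .cross b), (0, .death)]) rfl
      (hlen h) ?_
    rintro (_ | ⟨⟨⟨⟩, x⟩, R⟩) R'
    · simp [run, step]
    · cases o <;> cases x <;> simp [run, step, weight, Piece.weight, eq_comm, add_comm]

theorem weight_circle {κ : ZMod 2} {i : ℕ} {o : Bool} {S T : Level Unit}
    (h : run S [(i, .birth () o), (i, .death)] = some T) :
    T = S ∧ weight 1 κ S [(i, .birth () o), (i, .death)] = 1 := by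
  refine weight_local h (i := i) (w := [(0, .birth () o), (0, .death)]) rfl ?_ ?_
  · by_contra hl
    rw [run_eq_none_of_lt (by omega)] at h
    simp at h
  · rintro R R'
    cases o <;> simp [run, step, weight, Piece.weight, eq_comm]

/-! ### Signs and twisted HOMFLY polynomials -/

/-- The sign `(-1) ^ x` for an exponent modulo `2`. -/
def sgn {R : Type*} [Ring R] (x : ZMod 2) : R := if x = 0 then 1 else -1

section Sign

variable {R : Type*} [Ring R]

theorem sgn_zero : (sgn 0 : R) = 1 := rfl

theorem sgn_one : (sgn 1 : R) = -1 := rfl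

theorem sgn_add (x y : ZMod 2) : (sgn (x + y) : R) = sgn x * sgn y := by
  have : ∀ x : ZMod 2, x = 0 ∨ x = 1 := by decide
  have h2 : (1 + 1 : ZMod 2) = 0 := by decide
  rcases this x with rfl | rfl <;> rcases this y with rfl | rfl <;>
    simp [sgn_zero, sgn_one, h2]

theorem sgn_mul_self (x : ZMod 2) : (sgn x * sgn x : R) = 1 := by
  rw [← sgn_add, CharTwo.add_self_eq_zero, sgn_zero]

theorem sgn_natCast (n : ℕ) : (sgn (n : ZMod 2) : R) = (-1) ^ n := by
  induction n with
  | zero => simp [sgn_zero]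
  | succ n ih => rw [Nat.cast_succ, sgn_add, ih, sgn_one, pow_succ]

end Sign

theorem weight_replace {κ δ : ZMod 2} {x m y : Diagram} (h : Closed (x ++ m ++ y))
    (hm : ∀ S T : Level Unit, run S m = some T → T = S ∧ weight 1 κ S m = δ) :
    Closed (x ++ y) ∧ weight 1 κ [] (x ++ m ++ y) = weight 1 κ [] (x ++ y) + δ := by
  obtain ⟨T, hT, hy⟩ := run_append_eq_some.1 h
  obtain ⟨S, hx, hS⟩ := run_append_eq_some.1 hT
  obtain ⟨rfl, hw⟩ := hm S T hS
  refine ⟨run_append_eq_some.2 ⟨T, hx, hy⟩, ?_⟩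
  rw [weight_append _ _ hT, weight_append _ _ hx, weight_append _ _ hx, hw]
  ring

/-- A substitution that maps the coefficients in the defining relations to themselves up to the
signs determined by `κ` maps the framed HOMFLY polynomial to itself up to signs. -/
theorem IsFramedHomfly.twist {H : Diagram → Scalars} (hH : IsFramedHomfly H)
    (φ : Scalars →+* Scalars) (κ : ZMod 2)
    (hb : φ (LaurentPolynomial.C (bracket 1)) = sgn κ * LaurentPolynomial.C (bracket 1))
    (hv : ∀ b : Bool, φ (v (if b then -1 else 1)) = sgn (κ + 1) * v (if b then -1 else 1)) :
    IsFramedHomfly fun D => sgn (weight 1 κ [] D) * φ (H D) := by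
  have hκ : (sgn κ * sgn κ : Scalars) = 1 := sgn_mul_self κ
  constructor
  · intro x hx
    simp [hH.eq_zero x hx]
  · simp [hH.empty, weight, sgn_zero]
  -- The circle has weight 1, and the resulting sign -1 is the quotient of `sgn (κ + 1)` and `sgn
  -- κ`, the signs that `φ` puts on the two sides.
  · intro x y i o h
    obtain ⟨-, hw⟩ := weight_replace (κ := κ) h fun S T => weight_circle
    have h1 := congrArg φ (hH.circle x y i o h)
    have hp : φ (v (-1)) = sgn (κ + 1) * v (-1) := hv true
    have hm : φ (v 1) = sgn (κ + 1) * v 1 := hv false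
    rw [map_mul, map_mul, hb, map_sub, hp, hm] at h1
    simp only [hw, sgn_add, sgn_one] at h1 ⊢
    linear_combination
      (-sgn (weight 1 κ [] (x ++ y)) * sgn κ) * h1 +
      sgn (weight 1 κ [] (x ++ y)) * (LaurentPolynomial.C (bracket 1) *
        φ (H (x ++ [(i, Piece.birth () o), (i, Piece.death)] ++ y)) +
          (v (-1) - v 1) * φ (H (x ++ y))) * hκ
  · intro x y m m' hm h h'
    rw [hH.move x y m m' hm h h']
    obtain ⟨T, hT, hy⟩ := run_append_eq_some.1 h
    obtain ⟨S, hx, hS⟩ := run_append_eq_some.1 hT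
    obtain ⟨T', hT', -⟩ := run_append_eq_some.1 h'
    obtain ⟨S', hx', hS'⟩ := run_append_eq_some.1 hT'
    obtain rfl : S = S' := Option.some.inj (hx.symm.trans hx')
    obtain ⟨rfl, hw⟩ := hm.weight_eq (κ := κ) hS hS'
    rw [weight_append _ _ hT, weight_append _ _ hT', weight_append _ _ hx,
      weight_append _ _ hx, hw]
  · intro x y m b hm h
    obtain ⟨-, hw⟩ := weight_replace (κ := κ) h fun S T => hm.weight_eq
    rw [hH.curl x y m b hm h, map_mul, hv, hw, sgn_add]
    linear_combination sgn (weight 1 κ [] (x ++ y)) * v (if b then -1 else 1) *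
      φ (H (x ++ y)) * sgn_mul_self (R := Scalars) (κ + 1)
  · intro x y i hp h
    have h1 := congrArg φ (hH.skein x y i hp h)
    rw [map_sub, map_mul, hb] at h1
    obtain ⟨S, S', ⟨⟨⟩, a⟩, ⟨⟨⟩, b⟩, hx, rfl, rfl⟩ := hp
    -- Parallel unlabelled strands are indistinguishable, so the crossing returns the same level.
    -- Either type of crossing therefore adds exactly `κ` to the weight of the smoothing.
    have hw : ∀ u, weight 1 κ [] (x ++ [(S.length, .cross u)] ++ y)
        = weight 1 κ [] (x ++ y) + κ := fun u => by
      have hs : run (S ++ ((), a) :: ((), a) :: S') [(S.length, .cross u)] =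
          some (S ++ ((), a) :: ((), a) :: S') := by simp [run, step]
      rw [List.append_assoc, weight_append _ _ hx, weight_append _ _ hs, weight_append _ _ hx]
      simp [weight, Piece.weight]
      ring
    simp only [hw, sgn_add]
    linear_combination (sgn (weight 1 κ [] (x ++ y)) * sgn κ) * h1 +
      sgn (weight 1 κ [] (x ++ y)) * LaurentPolynomial.C (bracket 1) * φ (H (x ++ y)) * hκ

/-! ### The substitutions on scalars -/

theorem invertCoeff_s : invertCoeff (s : Coeff) = ((s⁻¹ : Coeffˣ) : Coeff) := by
  have hs : (s : Coeff) = algebraMap (Polynomial ℚ) Coeff Polynomial.X := rfl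
  rw [hs, invertCoeff, IsLocalization.lift_eq]
  simp

theorem map_invertCoeff_s : Units.map invertCoeff.toMonoidHom s = s⁻¹ :=
  Units.ext invertCoeff_s

theorem invertCoeff_zpow (n : ℤ) :
    invertCoeff ((s ^ n : Coeffˣ) : Coeff) = ((s ^ (-n) : Coeffˣ) : Coeff) := by
  have h : Units.map invertCoeff.toMonoidHom (s ^ n) = s ^ (-n) := by
    rw [map_zpow, map_invertCoeff_s, inv_zpow, zpow_neg]
  exact congrArg Units.val h

theorem invertCoeff_bracket (k : ℕ) : invertCoeff (bracket k) = -bracket k := by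
  rw [bracket, map_sub, invertCoeff_zpow, invertCoeff_zpow]
  simp

theorem substInvS_C (a : Coeff) :
    substInvS (LaurentPolynomial.C a) = LaurentPolynomial.C (invertCoeff a) := by
  simp [substInvS]

theorem substNegV_C (a : Coeff) : substNegV (LaurentPolynomial.C a) = LaurentPolynomial.C a := by
  simp [substNegV]

theorem v_add (a b : ℤ) : v (a + b) = v a * v b := LaurentPolynomial.T_add a b

theorem vUnit_zpow (n : ℤ) : ((vUnit ^ n : Scalarsˣ) : Scalars) = v n := by
  induction n using Int.induction_on with
  | zero => simp [v]
  | succ n ih => rw [zpow_add_one, Units.val_mul, ih, v_add]; rfl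
  | pred n ih => rw [zpow_sub_one, Units.val_mul, ih, sub_eq_add_neg, v_add]; rfl

theorem substInvS_v (n : ℤ) : substInvS (v n) = v n := by
  conv_lhs => rw [substInvS, v, LaurentPolynomial.eval₂_T, vUnit_zpow]

theorem substNegV_v (n : ℤ) : substNegV (v n) = sgn (n : ZMod 2) * v n := by
  conv_lhs => rw [substNegV, v, LaurentPolynomial.eval₂_T]
  rcases n.even_or_odd with h | h
  · rw [h.neg_zpow, vUnit_zpow, (ZMod.intCast_eq_zero_iff_even).2 h, sgn_zero, one_mul]
  · rw [h.neg_zpow, Units.val_neg, vUnit_zpow, (ZMod.intCast_eq_one_iff_odd).2 h, sgn_one,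
      neg_one_mul]

theorem inclT_C (a : Coeff) : inclT (LaurentPolynomial.C a) = LaurentPolynomial.C a := by
  simp [inclT]

theorem inclT_T (n : ℤ) : inclT (LaurentPolynomial.T n) = v (2 * n) := by
  rw [inclT, LaurentPolynomial.eval₂_T, ← zpow_natCast, ← zpow_mul, vUnit_zpow]
  rfl

/-- Laurent polynomials in `v` that are even are Laurent polynomials in `t = v ^ 2`. -/
theorem exists_inclT_of_substNegV_eq {x : Scalars} (h : substNegV x = x) :
    ∃ P, x = inclT P := by
  have key : ∀ x : Scalars, ∃ P, x + substNegV x = inclT P := fun x => by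
    induction x using LaurentPolynomial.induction_on' with
    | add p q hp hq =>
      obtain ⟨P, hP⟩ := hp
      obtain ⟨Q, hQ⟩ := hq
      exact ⟨P + Q, by rw [map_add, map_add, ← hP, ← hQ]; ring⟩
    | C_mul_T n a =>
      have hn := substNegV_v n
      rw [v] at hn
      rw [map_mul, substNegV_C, hn]
      rcases n.even_or_odd with h | h
      · obtain ⟨k, rfl⟩ := h
        refine ⟨2 * (LaurentPolynomial.C a * LaurentPolynomial.T k), ?_⟩
        rw [(ZMod.intCast_eq_zero_iff_even).2 ⟨k, rfl⟩, sgn_zero, map_mul, map_mul, inclT_C,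
          inclT_T, map_ofNat, v, two_mul k]
        ring
      · exact ⟨0, by rw [(ZMod.intCast_eq_one_iff_odd).2 h, sgn_one, map_zero]; ring⟩
  obtain ⟨P, hP⟩ := key x
  have h2 : (LaurentPolynomial.C (algebraMap ℚ Coeff (1 / 2)) : Scalars) * 2 = 1 := by
    rw [← map_ofNat LaurentPolynomial.C 2, ← map_ofNat (algebraMap ℚ Coeff) 2, ← map_mul,
      ← map_mul]
    norm_num
  refine ⟨LaurentPolynomial.C (algebraMap ℚ Coeff (1 / 2)) * P, ?_⟩
  rw [map_mul, inclT_C, ← hP, h]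
  linear_combination -x * h2

/-- Multiplication by `v ^ (-n)` turns an element of the parity of `n` into an even one. -/
theorem exists_inclT_of_substNegV {x : Scalars} {n : ℤ} (h : substNegV x = sgn (n : ZMod 2) * x) :
    ∃ P, v (-n) * x = inclT P := by
  refine exists_inclT_of_substNegV_eq ?_
  rw [map_mul, substNegV_v, h]
  have h1 : ((-n : ℤ) : ZMod 2) = n := by
    rw [Int.cast_neg, CharTwo.neg_eq]
  rw [h1]
  linear_combination v (-n) * x * sgn_mul_self (R := Scalars) (n : ZMod 2)

/-! ### Symmetries of the framed HOMFLY polynomial -/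

theorem homfly_eq {H : Diagram → Scalars} (hu : ∃! H : Diagram → Scalars, IsFramedHomfly H)
    (hH : IsFramedHomfly H) : H = homfly := by
  rw [homfly, dif_pos hu]
  exact hu.unique hH hu.choose_spec.1

theorem isFramedHomfly_homfly (hu : ∃! H : Diagram → Scalars, IsFramedHomfly H) :
    IsFramedHomfly homfly := by
  rw [homfly, dif_pos hu]
  exact hu.choose_spec.1

/-- The default value 0 satisfies every symmetry in question; this disposes of the case without
existence and uniqueness. -/
theorem homfly_eq_zero (hu : ¬ ∃! H : Diagram → Scalars, IsFramedHomfly H) (D : Diagram) :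
    homfly D = 0 := by
  rw [homfly, dif_neg hu]
  rfl

/-- The bracket [1] is odd under `s ↦ s⁻¹` and `v` is fixed, which is the sign pattern of the twist
with `κ = 1`. -/
theorem substInvS_homfly (D : Diagram) :
    substInvS (homfly D) = sgn (weight 1 1 [] D) * homfly D := by
  by_cases hu : ∃! H : Diagram → Scalars, IsFramedHomfly H
  · have h := (isFramedHomfly_homfly hu).twist substInvS 1
      (by rw [substInvS_C, invertCoeff_bracket, map_neg, sgn_one, neg_one_mul])
      (fun b => by rw [substInvS_v, CharTwo.add_self_eq_zero, sgn_zero, one_mul])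
    have h2 := congrFun (homfly_eq hu h) D
    conv_rhs => rw [← h2]
    rw [← mul_assoc, sgn_mul_self, one_mul]
  · simp [homfly_eq_zero hu]

/-- Here [1] is fixed and the curl factors change sign, so `κ = 0` and only the turning number
matters. -/
theorem substNegV_homfly (D : Diagram) :
    substNegV (homfly D) = sgn (weight 1 0 [] D) * homfly D := by
  by_cases hu : ∃! H : Diagram → Scalars, IsFramedHomfly H
  · have h := (isFramedHomfly_homfly hu).twist substNegV 0
      (by rw [substNegV_C, sgn_zero, one_mul])
      (fun b => by rw [substNegV_v]; cases b <;> rfl)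
    have h2 := congrFun (homfly_eq hu h) D
    conv_rhs => rw [← h2]
    rw [← mul_assoc, sgn_mul_self, one_mul]
  · simp [homfly_eq_zero hu]

/-- The degrees in `t` of the framed HOMFLY polynomial are all integers or all half-integers. -/
theorem homfly_mem (D : Diagram) :
    (∃ P, homfly D = inclT P) ∨ ∃ P, homfly D = v 1 * inclT P := by
  have : ∀ x : ZMod 2, x = 0 ∨ x = 1 := by decide
  have h := substNegV_homfly D
  rcases this (weight 1 0 [] D) with h0 | h0 <;> rw [h0] at h
  · rw [sgn_zero, one_mul] at h
    exact Or.inl (exists_inclT_of_substNegV_eq h)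
  · obtain ⟨P, hP⟩ := exists_inclT_of_substNegV (n := 1) (by simpa using h)
    refine Or.inr ⟨P, ?_⟩
    rw [← hP, ← mul_assoc, ← v_add]
    simp [v]

/-! ### The weight of a satellite -/

/-- The diagram `w` leads from the level `S` to the level `T`, and its weight is `δ`. -/
def Runs {ι : Type} [DecidableEq ι] (m : ι → ZMod 2) (κ : ZMod 2) (S : Level ι) (w : Word ι)
    (T : Level ι) (δ : ZMod 2) : Prop :=
  run S w = some T ∧ weight m κ S w = δ

section Runs

variable {ι : Type} [DecidableEq ι] {m : ι → ZMod 2} {κ : ZMod 2}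

theorem Runs.nil (S : Level ι) : Runs m κ S [] S 0 := ⟨rfl, rfl⟩

theorem Runs.append {S T U : Level ι} {w w' : Word ι} {δ ε : ZMod 2}
    (h : Runs m κ S w T δ) (h' : Runs m κ T w' U ε) : Runs m κ S (w ++ w') U (δ + ε) :=
  ⟨run_append_eq_some.2 ⟨T, h.1, h'.1⟩, by rw [weight_append _ _ h.1, h.2, h'.2]⟩

theorem Piece.Acts.runs {g : Piece ι} {I O : Level ι} (h : g.Acts I O) (A B : Level ι) {i : ℕ}
    (hi : A.length = i) :
    Runs m κ (A ++ (I ++ B)) [(i, g)] (A ++ (O ++ B)) (g.weight m κ I) := by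
  refine ⟨?_, ?_⟩
  · rw [run_cons_of_acts h A B hi, run]
  · rw [weight_cons_of_acts m κ h A B hi]
    exact add_zero _

theorem Runs.congr {S S' T T' : Level ι} {w w' : Word ι} {δ δ' : ZMod 2}
    (h : Runs m κ S w T δ) (hS : S = S') (hw : w = w') (hT : T = T') (hδ : δ = δ') :
    Runs m κ S' w' T' δ' := by
  subst hS hw hT hδ
  exact h

end Runs

/-- `n` parallel local minima. -/
def cups (off n : ℕ) (o : Bool) : Diagram := (List.range n).map fun k => (off + k, .birth () o)

/-- `n` parallel local maxima. -/
def caps (off n : ℕ) : Diagram := (List.range n).reverse.map fun k => (off + k, .death)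

/-- The crossing of a strand with `n` parallel strands. -/
def crossRow (off n : ℕ) (b : Bool) : Diagram :=
  (List.range n).map fun j => (off + j, .cross b)

/-- The crossing of `n` parallel strands with `n'` parallel strands. -/
def crossGrid (off n n' : ℕ) (b : Bool) : Diagram :=
  (List.range n).reverse.flatMap fun k => crossRow (off + k) n' b

/-- A positive braid placed at the columns from `off` on. -/
def braid (off : ℕ) (p : List ℕ) : Diagram := p.map fun k => (off + k, .cross true)

section Cables

variable {κ : ZMod 2}

theorem cups_succ (off n : ℕ) (o : Bool) :
    cups off (n + 1) o = cups off n o ++ [(off + n, .birth () o)] := by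
  simp [cups, List.range_succ]

theorem caps_succ (off n : ℕ) : caps off (n + 1) = (off + n, .death) :: caps off n := by
  simp [caps, List.range_succ]

theorem crossRow_succ (off n : ℕ) (b : Bool) :
    crossRow off (n + 1) b = crossRow off n b ++ [(off + n, .cross b)] := by
  simp [crossRow, List.range_succ]

theorem crossGrid_succ (off n n' : ℕ) (b : Bool) :
    crossGrid off (n + 1) n' b = crossRow (off + n) n' b ++ crossGrid off n n' b := by
  simp [crossGrid, List.range_succ]

theorem runs_cups (A B : Level Unit) (n : ℕ) (o : Bool) :
    Runs 1 κ (A ++ B) (cups A.length n o)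
      (A ++ (List.replicate n ((), o) ++ (List.replicate n ((), !o) ++ B)))
      (if o then 0 else n) := by
  induction n with
  | zero => exact (Runs.nil _).congr rfl rfl (by simp) (by simp)
  | succ n ih =>
    refine (ih.append (((Piece.Acts.birth () o).runs (A ++ List.replicate n ((), o))
      (List.replicate n ((), !o) ++ B) (i := A.length + n) (by simp)).congr ?_ rfl rfl rfl)).congr
      rfl (cups_succ _ _ _).symm ?_ ?_
    · simp
    · rw [List.replicate_succ', List.replicate_succ]
      simp
    · cases o <;> simp [Piece.weight]

theorem runs_caps (A B : Level Unit) (n : ℕ) (o : Bool) :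
    Runs 1 κ (A ++ (List.replicate n ((), o) ++ (List.replicate n ((), !o) ++ B)))
      (caps A.length n) (A ++ B) (if o then n else 0) := by
  induction n with
  | zero => exact (Runs.nil _).congr (by simp) rfl rfl (by simp)
  | succ n ih =>
    refine (((Piece.Acts.death () o).runs (A ++ List.replicate n ((), o))
      (List.replicate n ((), !o) ++ B) (i := A.length + n) (by simp)).append
      (ih.congr ?_ rfl rfl rfl)).congr ?_
      (caps_succ _ _).symm rfl ?_
    · simp
    · rw [List.replicate_succ', List.replicate_succ]
      simp
    · cases o <;> simp [Piece.weight, add_comm]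

theorem runs_crossRow (A B Y : Level Unit) (x : Unit × Bool) (b : Bool) :
    Runs 1 κ (A ++ x :: (Y ++ B)) (crossRow A.length Y.length b) (A ++ (Y ++ x :: B))
      (κ * Y.length) := by
  induction Y using List.reverseRecOn generalizing B with
  | nil => exact (Runs.nil _).congr rfl rfl rfl (by simp)
  | append_singleton Y y ih =>
    refine ((ih (y :: B)).append (((Piece.Acts.cross b x y).runs (A ++ Y) B
      (i := A.length + Y.length) (by simp)).congr ?_ rfl rfl rfl)).congr ?_ ?_ ?_ ?_
    · simp
    · simp
    · rw [List.length_append, List.length_singleton, crossRow_succ]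
    · simp
    · simp [Piece.weight, mul_add]

theorem runs_crossGrid (A B X Y : Level Unit) (b : Bool) :
    Runs 1 κ (A ++ (X ++ (Y ++ B))) (crossGrid A.length X.length Y.length b)
      (A ++ (Y ++ (X ++ B))) (κ * (X.length * Y.length)) := by
  induction X using List.reverseRecOn generalizing B with
  | nil => exact (Runs.nil _).congr rfl rfl rfl (by simp)
  | append_singleton X x ih =>
    refine ((((runs_crossRow (κ := κ) (A ++ X) B Y x b).congr
      (S' := A ++ (X ++ (x :: (Y ++ B)))) ?_ ?_ ?_ rfl).append
      (ih (x :: B)))).congr (w := crossRow (A.length + X.length) Y.length b ++ _) ?_ ?_ ?_ ?_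
    · simp
    · simp
    · simp
    · simp
    · rw [List.length_append, List.length_singleton, crossGrid_succ]
    · simp
    · simp
      ring

theorem exists_split {α : Type} {S : List α} {i : ℕ} (h : i ≤ S.length) :
    ∃ A B, S = A ++ B ∧ A.length = i :=
  ⟨S.take i, S.drop i, by simp, by simpa using h⟩

/-- The strands of one cable share their orientation, so the braid does not change the level and
each of its crossings counts `κ`. -/
theorem runs_braid (A X B : Level Unit) {p : List ℕ} {o : Bool} (hX : ∀ x ∈ X, x.2 = o)
    (hp : ∀ k ∈ p, k + 1 < X.length) :
    Runs 1 κ (A ++ (X ++ B)) (braid A.length p) (A ++ (X ++ B)) (κ * p.length) := by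
  induction p with
  | nil => exact (Runs.nil _).congr rfl rfl rfl (by simp)
  | cons k p ih =>
    have hk := hp k (by simp)
    have h1 := ih fun j hj => hp j (by simp [hj])
    obtain ⟨X₁, X₂, rfl, rfl⟩ := exists_split (S := X) (i := k) (by omega)
    rcases X₂ with _ | ⟨x, _ | ⟨y, X₂⟩⟩
    · simp at hk
    · simp at hk
    · obtain rfl : x = y := Prod.ext rfl ((hX x (by simp)).trans (hX y (by simp)).symm)
      refine (((Piece.Acts.cross true x x).runs (A ++ X₁) (X₂ ++ B)
        (i := A.length + X₁.length) (by simp)).append (h1.congr ?_ rfl rfl rfl)).congr ?_ ?_ ?_ ?_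
      · simp
      · simp
      · rfl
      · simp
      · simp [Piece.weight, mul_add, add_comm]

end Cables

section Satellite

variable {ι : Type} [DecidableEq ι]

/-- The level of the satellite, in which a strand labelled `c` is replaced by `m c` strands. -/
def expand (m : ι → ℕ) (S : Level ι) : Level Unit :=
  S.flatMap fun a => List.replicate (m a.1) ((), a.2)

omit [DecidableEq ι] in
theorem expand_append (m : ι → ℕ) (S T : Level ι) :
    expand m (S ++ T) = expand m S ++ expand m T := by simp [expand]

omit [DecidableEq ι] in
theorem expand_cons (m : ι → ℕ) (a : ι × Bool) (S : Level ι) :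
    expand m (a :: S) = List.replicate (m a.1) ((), a.2) ++ expand m S := rfl

omit [DecidableEq ι] in
theorem expand_nil (m : ι → ℕ) : expand m ([] : Level ι) = [] := rfl

omit [DecidableEq ι] in
-- Identifies the offset used in the definition of the satellite with the width of the cables to the
-- left.
theorem sum_widths (m : ι → ℕ) (A B : Level ι) :
    ((List.range A.length).map fun k =>
      (((A ++ B)[k]?).map fun a => m a.1).getD 0).sum = (expand m A).length := by
  induction A using List.reverseRecOn generalizing B with
  | nil => rfl
  | append_singleton A a ih =>
    rw [List.length_append, List.length_singleton, List.range_succ, List.map_append,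
      List.sum_append, List.append_assoc, ih, expand_append, List.length_append]
    simp [expand]

theorem satelliteFrom_birth (m : ι → ℕ) (p : ι → List ℕ) (done : List ι) (A B : Level ι) (c : ι)
    (o : Bool) (w : Word ι) :
    satelliteFrom m p done (A ++ B) ((A.length, .birth c o) :: w)
      = cups (expand m A).length (m c) o ++
        (if c ∈ done then [] else
          braid (if o then (expand m A).length else (expand m A).length + m c) (p c)) ++
        satelliteFrom m p (c :: done) (A ++ (c, o) :: (c, !o) :: B) w := by
  have h := step_of_acts (.birth c o) A B rfl
  rw [List.nil_append] at h
  rw [satelliteFrom, h]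
  simp only [sum_widths]
  rfl

theorem satelliteFrom_death (m : ι → ℕ) (p : ι → List ℕ) (done : List ι) (A B : Level ι) (c : ι)
    (o : Bool) (w : Word ι) :
    satelliteFrom m p done (A ++ (c, o) :: (c, !o) :: B) ((A.length, .death) :: w)
      = caps (expand m A).length (m c) ++ satelliteFrom m p done (A ++ B) w := by
  have h := step_of_acts (.death c o) A B rfl
  simp only [List.cons_append, List.nil_append] at h
  rw [satelliteFrom, h]
  simp only [sum_widths]
  simp [caps]

theorem satelliteFrom_cross (m : ι → ℕ) (p : ι → List ℕ) (done : List ι) (A B : Level ι)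
    (a a' : ι × Bool) (b : Bool) (w : Word ι) :
    satelliteFrom m p done (A ++ a :: a' :: B) ((A.length, .cross b) :: w)
      = crossGrid (expand m A).length (m a.1) (m a'.1) b ++
        satelliteFrom m p done (A ++ a' :: a :: B) w := by
  have h := step_of_acts (.cross b a a') A B rfl
  simp only [List.cons_append, List.nil_append] at h
  rw [satelliteFrom, h]
  simp only [sum_widths]
  simp [crossGrid, crossRow]

/-- The labels of the local minima. -/
def birthLabels : Word ι → Finset ι
  | [] => ∅
  | (_, .birth c _) :: w => insert c (birthLabels w)
  | (_, .death) :: w => birthLabels w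
  | (_, .cross _) :: w => birthLabels w

/-- The positive braid `p` fits on `n` strands. -/
def Fits (n : ℕ) (p : List ℕ) : Prop := ∀ k ∈ p, k + 1 < n

/-- An extremum of a strand labelled `c` becomes `m c` nested ones, and a crossing becomes a grid
whose size is the product of the two multiplicities; this is what `weight` with multiplicities
counts. The braid of a label enters only at its first local minimum, hence the sum over the labels
outside `done`. -/
theorem runs_satelliteFrom {m : ι → ℕ} {p : ι → List ℕ} {κ : ZMod 2}
    (hp : ∀ c, Fits (m c) (p c)) {S T : Level ι} {w : Word ι} (h : run S w = some T)
    (done : List ι) :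
    Runs 1 κ (expand m S) (satelliteFrom m p done S w) (expand m T)
      (weight (fun c => (m c : ZMod 2)) κ S w +
        κ * ∑ c ∈ birthLabels w \ done.toFinset, ((p c).length : ZMod 2)) := by
  induction w generalizing S done with
  | nil =>
    obtain rfl : S = T := by simpa [run] using h
    exact (Runs.nil _).congr rfl rfl rfl (by simp [weight, birthLabels])
  | cons e w ih =>
    obtain ⟨i, g⟩ := e
    obtain ⟨R, hR, hw⟩ := run_cons_eq_some.1 h
    obtain ⟨A, I, O, B, rfl, rfl, hg, rfl⟩ := exists_of_step hR
    rw [weight_cons_of_acts _ _ hg _ _ rfl]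
    cases hg with
    | birth c o =>
      have h1 := runs_cups (κ := κ) (expand m A) (expand m B) (m c) o
      have h2 : Runs 1 κ (expand m A ++ (List.replicate (m c) ((), o) ++
          (List.replicate (m c) ((), !o) ++ expand m B)))
          (if c ∈ done then [] else
            braid (if o then (expand m A).length else (expand m A).length + m c) (p c))
          (expand m A ++ (List.replicate (m c) ((), o) ++
          (List.replicate (m c) ((), !o) ++ expand m B)))
          (if c ∈ done then 0 else κ * (p c).length) := by
        split_ifs with hc ho
        · exact Runs.nil _
        · exact runs_braid _ _ _ (o := o) (by simp) fun k hk => by simpa using hp c k hk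
        · exact (runs_braid (expand m A ++ List.replicate (m c) ((), o))
            (List.replicate (m c) ((), !o)) (expand m B) (o := !o) (by simp)
            fun k hk => by simpa using hp c k hk).congr (by simp) (by simp) (by simp) rfl
      have h3 := ih hw (c :: done)
      simp only [List.nil_append, List.cons_append] at h3
      rw [List.nil_append, satelliteFrom_birth]
      refine ((h1.append h2).append (h3.congr ?_ rfl rfl rfl)).congr ?_ rfl rfl ?_
      · simp [expand_append, expand_cons]
      · simp [expand_append]
      · simp only [Piece.weight, birthLabels, List.cons_append, List.nil_append]
        split_ifs with ho hc hc
        all_goals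
          first
          | rw [← List.mem_toFinset] at hc
            rw [List.toFinset_cons, Finset.insert_eq_of_mem hc, Finset.insert_sdiff_of_mem _ hc]
            ring
          -- First minimum of `c`: its braid is counted here and must be absent from the sum for the
          -- rest of the diagram, where `c` has joined `done`.
          | have : insert c (birthLabels w) \ done.toFinset =
                insert c (birthLabels w \ (c :: done).toFinset) := by
              ext x
              by_cases hx : x = c <;> simp [hx, hc]
            rw [this, Finset.sum_insert (by simp)]
            ring
    | death c o =>
      have h1 := runs_caps (κ := κ) (expand m A) (expand m B) (m c) o
      simp only [List.nil_append, List.cons_append]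
      rw [satelliteFrom_death]
      refine (h1.append ((ih hw done).congr ?_ rfl rfl rfl)).congr ?_ rfl rfl ?_
      · simp [expand_append]
      · simp [expand_append, expand_cons]
      · simp [Piece.weight, birthLabels, add_assoc]
    | cross b a a' =>
      have h1 := runs_crossGrid (κ := κ) (expand m A) (expand m B)
        (List.replicate (m a.1) ((), a.2)) (List.replicate (m a'.1) ((), a'.2)) b
      simp only [List.nil_append, List.cons_append]
      rw [satelliteFrom_cross]
      refine (h1.append ((ih hw done).congr ?_ rfl rfl rfl)).congr ?_ ?_ rfl ?_
      · simp [expand_append, expand_cons]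
      · simp [expand_append, expand_cons]
      · simp
      · simp [Piece.weight, birthLabels, add_assoc]

end Satellite

/-! ### Inversion numbers modulo 2 -/

section Inversions

variable {α : Type} (key : α → ℕ) (μ : α → ZMod 2)

/-- The contribution of two elements of a list to the number of inversions. -/
def inversion (x y : α) : ZMod 2 := if key y < key x then μ x * μ y else 0

/-- The number of inversions of a list modulo `2`, with multiplicities. -/
def inversions : List α → ZMod 2
  | [] => 0
  | x :: l => (l.map (inversion key μ x)).sum + inversions l

variable {key μ}

theorem inversion_swap (hk : Function.Injective key) {x y : α} (h : x ≠ y) :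
    inversion key μ x y = inversion key μ y x + μ x * μ y := by
  have h1 : key x ≠ key y := fun h' => h (hk h')
  unfold inversion
  rcases lt_or_gt_of_ne h1 with h2 | h2
  · rw [if_neg h2.not_gt, if_pos h2, mul_comm (μ y), CharTwo.add_self_eq_zero]
  · rw [if_neg h2.not_gt, if_pos h2, zero_add]

theorem inversions_append_cons_cons (hk : Function.Injective key) (A B : List α) {x y : α}
    (h : x ≠ y) :
    inversions key μ (A ++ x :: y :: B) = inversions key μ (A ++ y :: x :: B) + μ x * μ y := by
  induction A with
  | nil =>
    simp only [List.nil_append, inversions, List.map_cons, List.sum_cons, inversion_swap hk h]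
    ring
  | cons a A ih =>
    simp only [List.cons_append, inversions, ih, List.map_append, List.map_cons, List.sum_append,
      List.sum_cons]
    ring

theorem inversions_move (hk : Function.Injective key) (A B C : List α) {x : α} (h : x ∉ B) :
    inversions key μ (A ++ x :: (B ++ C))
      = inversions key μ (A ++ (B ++ x :: C)) + μ x * (B.map μ).sum := by
  induction B generalizing A with
  | nil => simp
  | cons b B ih =>
    simp only [List.mem_cons, not_or] at h
    have h1 := ih (A ++ [b]) h.2
    simp only [List.append_assoc, List.cons_append, List.nil_append] at h1
    rw [List.cons_append, inversions_append_cons_cons hk _ _ h.1, h1]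
    simp
    ring

/-- Carrying `x` and `y` across `B` costs the same amount for both and cancels modulo 2. Only the
exchange of `x` with `y` remains, which costs `μ x * μ y = μ x` since squares are trivial in `ZMod
2`. -/
theorem inversions_exchange (hk : Function.Injective key) (A B C : List α) {x y : α} (h : x ≠ y)
    (hx : x ∉ B) (hy : y ∉ B) (hμ : μ x = μ y) :
    inversions key μ (A ++ x :: (B ++ y :: C)) = inversions key μ (A ++ y :: (B ++ x :: C)) + μ x := by
  have h1 := inversions_append_cons_cons (μ := μ) hk (A ++ B) C h
  simp only [List.append_assoc] at h1
  rw [inversions_move hk A B _ hx, h1, inversions_move hk A B _ hy, hμ]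
  have h2 : μ y * μ y = μ y := by
    generalize μ y = z
    revert z
    decide
  linear_combination h2

theorem map_swap_of_notMem [DecidableEq α] {l : List α} {x y : α} (hx : x ∉ l) (hy : y ∉ l) :
    l.map (Equiv.swap x y) = l := by
  rw [List.map_congr_left (g := id), List.map_id]
  intro a ha
  exact Equiv.swap_apply_of_ne_of_ne (fun h => hx (h ▸ ha)) fun h => hy (h ▸ ha)

theorem inversions_map_swap [DecidableEq α] (hk : Function.Injective key) {l : List α}
    (hl : l.Nodup) {x y : α} (h : x ≠ y) (hx : x ∈ l) (hy : y ∈ l) (hμ : μ x = μ y) :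
    inversions key μ (l.map (Equiv.swap x y)) = inversions key μ l + μ x := by
  have key' : ∀ (A B C : List α) {x y : α}, x ≠ y → μ x = μ y → (A ++ x :: (B ++ y :: C)).Nodup →
      inversions key μ ((A ++ x :: (B ++ y :: C)).map (Equiv.swap x y))
        = inversions key μ (A ++ x :: (B ++ y :: C)) + μ x := by
    intro A B C x y h hμ hl
    simp only [List.nodup_append, List.nodup_cons, List.mem_append, List.mem_cons] at hl
    obtain ⟨-, ⟨hx, -, ⟨hy, -⟩, hB⟩, hA⟩ := hl
    have hxA : x ∉ A := fun h => hA x h x (by simp) rfl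
    have hyA : y ∉ A := fun h => hA y h y (by simp) rfl
    have hyB : y ∉ B := fun h => hB y h y (by simp) rfl
    have hxB : x ∉ B := fun h => hx (Or.inl h)
    have hxC : x ∉ C := fun h => hx (Or.inr (Or.inr h))
    simp only [List.map_append, List.map_cons, map_swap_of_notMem hxA hyA,
      map_swap_of_notMem hxB hyB, map_swap_of_notMem hxC hy, Equiv.swap_apply_left,
      Equiv.swap_apply_right]
    rw [inversions_exchange hk A B C h.symm hyB hxB hμ.symm, hμ]
  obtain ⟨A, D, rfl⟩ := List.append_of_mem hx
  simp only [List.mem_append, List.mem_cons] at hy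
  rcases hy with hy | rfl | hy
  · obtain ⟨A, B, rfl⟩ := List.append_of_mem hy
    have := key' A B D h.symm hμ.symm (by simpa using hl)
    rw [Equiv.swap_comm, hμ]
    simpa using this
  · exact absurd rfl h
  · obtain ⟨B, C, rfl⟩ := List.append_of_mem hy
    exact key' A B C h hμ hl

/-- Every other element meets `x` and `y` with equal contributions, which cancel modulo 2. -/
theorem inversions_insert_pair (A B : List α) {x y : α}
    (h : ∀ a, a ∈ A ∨ a ∈ B → inversion key μ a x = inversion key μ a y ∧
      inversion key μ x a = inversion key μ y a) :
    inversions key μ (A ++ x :: y :: B) = inversions key μ (A ++ B) + inversion key μ x y := by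
  induction A with
  | nil =>
    have h1 : B.map (inversion key μ x) = B.map (inversion key μ y) :=
      List.map_congr_left fun a ha => (h a (Or.inr ha)).2
    simp only [List.nil_append, inversions, List.map_cons, List.sum_cons, h1]
    linear_combination CharTwo.add_self_eq_zero (B.map (inversion key μ y)).sum
  | cons a A ih =>
    have h1 := ih fun b hb => h b (hb.imp_left (List.mem_cons_of_mem _))
    simp only [List.cons_append, inversions, h1, List.map_append, List.map_cons, List.sum_append,
      List.sum_cons, (h a (Or.inl List.mem_cons_self)).1]
    linear_combination CharTwo.add_self_eq_zero (inversion key μ a y)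

end Inversions

/-! ### Relabelling diagrams -/

section Maps

variable {ι J : Type} [DecidableEq ι] [DecidableEq J]

omit [DecidableEq ι] [DecidableEq J] in
theorem Piece.Acts.map (f : ι → J) {g : Piece ι} {I O : Level ι} (h : g.Acts I O) :
    (g.map f).Acts (I.map (Prod.map f id)) (O.map (Prod.map f id)) := by
  cases h <;> constructor

theorem run_map (f : ι → J) {S T : Level ι} {w : Word ι} (h : run S w = some T) :
    run (S.map (Prod.map f id)) (w.map (Prod.map id (Piece.map f)))
      = some (T.map (Prod.map f id)) := by
  induction w generalizing S with
  | nil =>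
    obtain rfl : S = T := by simpa [run] using h
    rfl
  | cons e w ih =>
    obtain ⟨i, g⟩ := e
    obtain ⟨R, hR, hw⟩ := run_cons_eq_some.1 h
    obtain ⟨A, I, O, B, rfl, rfl, hg, rfl⟩ := exists_of_step hR
    have h1 := run_cons_of_acts (hg.map f) (A.map (Prod.map f id)) (B.map (Prod.map f id))
      (i := A.length) (by simp) (w.map (Prod.map id (Piece.map f)))
    have h2 := ih hw
    simp only [List.map_append] at h2 ⊢
    exact h1.trans h2

theorem birthLabels_append (w w' : Word ι) :
    birthLabels (w ++ w') = birthLabels w ∪ birthLabels w' := by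
  induction w with
  | nil => simp [birthLabels]
  | cons e w ih =>
    rcases e with ⟨i, _ | _ | _⟩ <;> simp [birthLabels, ih]

theorem mem_birthLabels {w : Word ι} {c : ι} :
    c ∈ birthLabels w ↔ ∃ i o, (i, Piece.birth c o) ∈ w := by
  induction w with
  | nil => simp [birthLabels]
  | cons e w ih =>
    rcases e with ⟨i, _ | _ | _⟩ <;> simp [birthLabels, ih, exists_or]

theorem birthLabels_map (f : ι → J) (w : Word ι) :
    birthLabels (w.map (Prod.map id (Piece.map f))) = (birthLabels w).image f := by
  induction w with
  | nil => rfl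
  | cons e w ih =>
    rcases e with ⟨i, _ | _ | _⟩ <;> simp [birthLabels, ih, Piece.map, Finset.image_insert]

end Maps

/-! ### Whitney's formula modulo 2, by scanning the diagram upwards -/

section Refinement

variable {ι : Type} [Encodable ι]

/-- An order on labelled oriented strands in which strands with the same label are adjacent. -/
def strandKey (a : (ι × ℕ) × Bool) : ℕ := 2 * Encodable.encode a.1 + if a.2 then 0 else 1

theorem strandKey_injective : Function.Injective (strandKey (ι := ι)) := by
  rintro ⟨l, a⟩ ⟨l', a'⟩ h
  simp only [strandKey] at h
  have : l = l' := Encodable.encode_injective (by split_ifs at h <;> omega)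
  subst this
  cases a <;> cases a' <;> simp_all

variable (m : ι → ZMod 2)

/-- The weight of a labelled oriented strand. -/
def strandWeight (a : (ι × ℕ) × Bool) : ZMod 2 := m a.1.1

variable {m}

theorem zmod_two_mul_self (x : ZMod 2) : x * x = x := by
  revert x
  decide

theorem inversion_same (l : ι × ℕ) (o : Bool) :
    inversion strandKey (strandWeight m) (l, o) (l, !o) = if o then 0 else m l.1 := by
  cases o <;> simp [inversion, strandKey, strandWeight, zmod_two_mul_self]

theorem inversion_label {a : (ι × ℕ) × Bool} {l : ι × ℕ} (h : a.1 ≠ l) (o o' : Bool) :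
    inversion strandKey (strandWeight m) a (l, o) = inversion strandKey (strandWeight m) a (l, o') ∧
    inversion strandKey (strandWeight m) (l, o) a =
      inversion strandKey (strandWeight m) (l, o') a := by
  have h1 : Encodable.encode a.1 ≠ Encodable.encode l := fun h' => h (Encodable.encode_injective h')
  have h2 : ∀ b, strandKey (l, b) < strandKey a ↔ Encodable.encode l < Encodable.encode a.1 :=
    fun b => by unfold strandKey; dsimp only; split_ifs <;> omega
  have h3 : ∀ b, strandKey a < strandKey (l, b) ↔ Encodable.encode a.1 < Encodable.encode l :=
    fun b => by unfold strandKey; dsimp only; split_ifs <;> omega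
  simp only [inversion, h2, h3, strandWeight, and_self]

theorem inversions_label_pair (A B : List ((ι × ℕ) × Bool)) {l : ι × ℕ} (o : Bool)
    (h : ∀ a, a ∈ A ∨ a ∈ B → a.1 ≠ l) :
    inversions strandKey (strandWeight m) (A ++ (l, o) :: (l, !o) :: B)
      = inversions strandKey (strandWeight m) (A ++ B) + if o then 0 else m l.1 := by
  rw [inversions_insert_pair A B fun a ha => inversion_label (h a ha) o (!o), inversion_same]

variable [DecidableEq ι]

/-- A labelling of the strands of a diagram that starts from the empty level by its components,
such that the components are distinguished by the labels. -/
structure IsRefinement (m : ι → ZMod 2) (w : Word ι) (S : Level ι) (w' : Word (ι × ℕ))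
    (S' : Level (ι × ℕ)) : Prop where
  run_eq : run [] w' = some S'
  map_word : w'.map (Prod.map id (Piece.map Prod.fst)) = w
  map_level : S'.map (Prod.map Prod.fst id) = S
  nodup : S'.Nodup
  paired : ∀ l b, (l, b) ∈ S' → (l, !b) ∈ S'
  mem_birthLabels : ∀ a ∈ S', a.1 ∈ birthLabels w'
  -- Over the empty level the inversions and the sum over upward strands vanish, so the weight
  -- becomes the number of components counted with `m`. The inversions compensate for the crossings;
  -- the upward strands compensate for labels created or lost at extrema.
  weight_eq : weight m 1 [] w + inversions strandKey (strandWeight m) S' +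
    ∑ l ∈ birthLabels w', m l.1 + (S.map fun a => if a.2 then m a.1 else 0).sum = 0

theorem bool_eq_or : ∀ x y : Bool, x = y ∨ x = !y := by decide

theorem IsRefinement.birth {w : Word ι} {w' : Word (ι × ℕ)} {A B : Level ι}
    {S' : Level (ι × ℕ)} (h : IsRefinement m w (A ++ B) w' S') (hw : run [] w = some (A ++ B))
    (c : ι) (o : Bool) :
    ∃ w'' S'', IsRefinement m (w ++ [(A.length, .birth c o)]) (A ++ (c, o) :: (c, !o) :: B)
      w'' S'' := by
  obtain ⟨A', B', rfl, hA, hB⟩ := List.map_eq_append_iff.1 h.map_level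
  obtain ⟨n, hn⟩ : ∃ n, (c, n) ∉ birthLabels w' := by
    obtain ⟨n, hn⟩ := Infinite.exists_notMem_finset ((birthLabels w').image Prod.snd)
    exact ⟨n, fun h' => hn (Finset.mem_image_of_mem _ h')⟩
  have hne : ∀ a, a ∈ A' ∨ a ∈ B' → a.1 ≠ (c, n) := fun a ha he =>
    hn (he ▸ h.mem_birthLabels a (by simpa using ha))
  have hU : birthLabels (w' ++ [(A.length, .birth (c, n) o)]) =
      insert (c, n) (birthLabels w') := by
    rw [birthLabels_append, Finset.union_comm]
    rfl
  refine ⟨w' ++ [(A.length, .birth (c, n) o)], A' ++ ((c, n), o) :: ((c, n), !o) :: B',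
    ?_, ?_, ?_, ?_, ?_, ?_, ?_⟩
  · rw [run_append, h.run_eq, Option.bind_some]
    exact run_cons_of_acts (.birth _ _) A' B' (by rw [← hA]; simp) []
  · rw [List.map_append, h.map_word]
    rfl
  · simp [← hA, ← hB]
  · have := h.nodup
    simp only [List.nodup_append, List.nodup_cons, List.mem_cons] at this ⊢
    refine ⟨this.1, ⟨?_, ?_, this.2.1⟩, ?_⟩
    · rintro (h' | h')
      · cases o <;> simp at h'
      · exact hne _ (Or.inr h') rfl
    · exact fun h' => hne _ (Or.inr h') rfl
    · rintro a ha b (rfl | rfl | hb) rfl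
      · exact hne _ (Or.inl ha) rfl
      · exact hne _ (Or.inl ha) rfl
      · exact this.2.2 _ ha _ hb rfl
  · intro l b hl
    have := h.paired l b
    simp only [List.mem_append, List.mem_cons, Prod.mk.injEq] at hl this ⊢
    rcases hl with hl | ⟨rfl, rfl⟩ | ⟨rfl, rfl⟩ | hl
    · rcases this (Or.inl hl) with h1 | h1 <;> simp [h1]
    · simp
    · simp
    · rcases this (Or.inr hl) with h1 | h1 <;> simp [h1]
  · rw [hU]
    intro a ha
    simp only [List.mem_append, List.mem_cons] at ha
    rw [Finset.mem_insert]
    rcases ha with ha | rfl | rfl | ha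
    · exact Or.inr (h.mem_birthLabels a (by simp [ha]))
    · exact Or.inl rfl
    · exact Or.inl rfl
    · exact Or.inr (h.mem_birthLabels a (by simp [ha]))
  -- The minimum adds the same amount to the weight and to the inversions, and the new label cancels
  -- against the new upward strand.
  · have h1 := h.weight_eq
    have h2 := weight_cons_of_acts m 1 (.birth c o) A B rfl []
    rw [List.nil_append] at h2
    rw [hU, Finset.sum_insert hn, inversions_label_pair _ _ _ hne, weight_append _ _ hw, h2]
    simp only [Piece.weight, weight, List.map_append, List.map_cons, List.sum_append,
      List.sum_cons] at h1 ⊢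
    have h3 := CharTwo.add_self_eq_zero (m c)
    cases o <;> simp <;> first | linear_combination h1 + h3 | linear_combination h1 + h3 + h3

theorem IsRefinement.cross {w : Word ι} {w' : Word (ι × ℕ)} {A B : Level ι}
    {S' : Level (ι × ℕ)} {a a' : ι × Bool} (h : IsRefinement m w (A ++ a :: a' :: B) w' S')
    (hw : run [] w = some (A ++ a :: a' :: B)) (b : Bool) :
    ∃ w'' S'', IsRefinement m (w ++ [(A.length, .cross b)]) (A ++ a' :: a :: B) w'' S'' := by
  obtain ⟨A', C, rfl, hA, hC⟩ := List.map_eq_append_iff.1 h.map_level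
  obtain ⟨x, C, rfl, hx, hC⟩ := List.map_eq_cons_iff.1 hC
  obtain ⟨y, B', rfl, hy, hB⟩ := List.map_eq_cons_iff.1 hC
  have hn := h.nodup
  have hxy : x ≠ y := by
    rintro rfl
    simp [List.nodup_append] at hn
  have hmem : ∀ z, z ∈ A' ++ y :: x :: B' ↔ z ∈ A' ++ x :: y :: B' := fun z => by
    simp only [List.mem_append, List.mem_cons]
    tauto
  have hU : birthLabels (w' ++ [(A.length, .cross b)]) = birthLabels w' := by
    rw [birthLabels_append]
    exact Finset.union_empty _
  refine ⟨w' ++ [(A.length, .cross b)], A' ++ y :: x :: B', ?_, ?_, ?_, ?_, ?_, ?_, ?_⟩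
  · rw [run_append, h.run_eq, Option.bind_some]
    exact run_cons_of_acts (.cross b x y) A' B' (by rw [← hA]; simp) []
  · rw [List.map_append, h.map_word]
    rfl
  · simp [← hA, ← hB, hx, hy]
  · refine (List.Perm.nodup_iff ?_).1 hn
    exact (List.Perm.swap _ _ _).append_left _
  · intro l b hl
    rw [hmem] at hl ⊢
    exact h.paired l b hl
  · intro z hz
    rw [hU]
    exact h.mem_birthLabels z ((hmem z).1 hz)
  -- With `κ = 1` the weight of the crossing is exactly the change in the number of inversions.
  · have h1 := h.weight_eq
    have h2 := weight_cons_of_acts m 1 (.cross b a a') A B rfl []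
    simp only [List.cons_append, List.nil_append] at h2
    rw [hU, weight_append _ _ hw, h2]
    rw [inversions_append_cons_cons strandKey_injective _ _ hxy] at h1
    simp only [Piece.weight, weight, List.map_append, List.map_cons, List.sum_append,
      List.sum_cons] at h1 ⊢
    have h3 : strandWeight m x = m a.1 := by rw [← hx]; rfl
    have h4 : strandWeight m y = m a'.1 := by rw [← hy]; rfl
    rw [h3, h4] at h1
    linear_combination h1

theorem IsRefinement.death {w : Word ι} {w' : Word (ι × ℕ)} {A B : Level ι}
    {S' : Level (ι × ℕ)} {c : ι} {o : Bool}
    (h : IsRefinement m w (A ++ (c, o) :: (c, !o) :: B) w' S')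
    (hw : run [] w = some (A ++ (c, o) :: (c, !o) :: B)) :
    ∃ w'' S'', IsRefinement m (w ++ [(A.length, .death)]) (A ++ B) w'' S'' := by
  obtain ⟨A', C, rfl, hA, hC⟩ := List.map_eq_append_iff.1 h.map_level
  obtain ⟨⟨x, o'⟩, C, rfl, hx, hC⟩ := List.map_eq_cons_iff.1 hC
  obtain ⟨⟨y, p⟩, B', rfl, hy, hB⟩ := List.map_eq_cons_iff.1 hC
  simp only [Prod.map_apply, id, Prod.mk.injEq] at hx hy
  obtain ⟨hx, rfl⟩ := hx
  obtain ⟨hy, rfl⟩ := hy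
  have hn := h.nodup
  have h1 := h.weight_eq
  have h2 := weight_cons_of_acts m 1 (.death c o') A B rfl []
  simp only [List.cons_append, List.nil_append] at h2
  simp only [List.map_append, List.map_cons, List.sum_append, List.sum_cons] at h1
  have hdisj : ∀ a, a ∈ A' ∨ a ∈ B' → a ≠ (x, o') ∧ a ≠ (y, !o') := by
    simp only [List.nodup_append, List.nodup_cons, List.mem_cons] at hn
    rintro a (ha | ha)
    · exact ⟨hn.2.2 a ha _ (Or.inl rfl), hn.2.2 a ha _ (Or.inr (Or.inl rfl))⟩
    · exact ⟨fun he => hn.2.1.1 (Or.inr (he ▸ ha)), fun he => hn.2.1.2.1 (he ▸ ha)⟩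
  have h5 := CharTwo.add_self_eq_zero (m c)
  -- If the labels agree, the maximum closes an arc to a component. Otherwise it joins two different
  -- arcs, whose labels must be merged.
  by_cases hxy : x = y
  · subst hxy
    have hne : ∀ a, a ∈ A' ∨ a ∈ B' → a.1 ≠ x := by
      rintro ⟨l, b⟩ ha rfl
      have := hdisj _ ha
      have h3 := bool_eq_or b o'
      rcases h3 with rfl | rfl <;> simp at this
    have hU : birthLabels (w' ++ [(A.length, .death)]) = birthLabels w' := by
      rw [birthLabels_append]
      exact Finset.union_empty _
    refine ⟨w' ++ [(A.length, .death)], A' ++ B', ?_, ?_, ?_, ?_, ?_, ?_, ?_⟩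
    · rw [run_append, h.run_eq, Option.bind_some]
      exact run_cons_of_acts (.death x o') A' B' (by rw [← hA]; simp) []
    · rw [List.map_append, h.map_word]
      rfl
    · simp [← hA, ← hB]
    · exact hn.sublist (((List.sublist_cons_self _ _).trans (List.sublist_cons_self _ _)).append_left _)
    · intro l b hl
      have h3 := h.paired l b
      have h4 := hne (l, b) (by simpa using hl)
      simp only [List.mem_append, List.mem_cons, Prod.mk.injEq, h4, false_and, false_or] at hl h3 ⊢
      exact h3 hl
    · intro a ha
      rw [hU]
      refine h.mem_birthLabels a ?_
      simp only [List.mem_append, List.mem_cons] at ha ⊢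
      tauto
    · rw [inversions_label_pair _ _ _ hne, hx] at h1
      rw [hU, weight_append _ _ hw, h2]
      simp only [Piece.weight, weight, List.map_append, List.sum_append]
      cases o' <;> simp at h1 ⊢ <;> first | linear_combination h1 | linear_combination h1 - h5
  -- Merging renames `y` to `x` throughout. On the remaining strands this agrees with the
  -- transposition of `(x, o')` and `(y, o')`, which also turns the two strands at the maximum into
  -- a pair with common label `y`. The transposition changes the inversions by `m c`, balancing the
  -- loss of the label `y`; then the pair is removed as in the first case.
  · let r : ι × ℕ → ι × ℕ := fun j => if j = y then x else j
    have hr : ∀ j, (r j).1 = j.1 := fun j => by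
      by_cases hj : j = y
      · simp [r, hj, hx, hy]
      · simp [r, hj]
    have hs : ∀ D : Level (ι × ℕ), (∀ a ∈ D, a ∈ A' ∨ a ∈ B') →
        D.map (Prod.map r id) = D.map (Equiv.swap (x, o') (y, o')) := fun D hD => by
      refine List.map_congr_left fun a ha => ?_
      obtain ⟨h3, h4⟩ := hdisj a (hD a ha)
      obtain ⟨l, b⟩ := a
      by_cases hl : l = y
      · subst hl
        rcases bool_eq_or b o' with rfl | rfl
        · simp [r]
        · exact absurd rfl h4
      · rw [Equiv.swap_apply_of_ne_of_ne h3 (fun he => hl (congrArg Prod.fst he))]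
        simp [r, hl]
    have hsA := hs A' fun a => Or.inl
    have hsB := hs B' fun a => Or.inr
    have hτ : (A' ++ (x, o') :: (y, !o') :: B').map (Equiv.swap (x, o') (y, o')) =
        A'.map (Prod.map r id) ++ (y, o') :: (y, !o') :: B'.map (Prod.map r id) := by
      rw [List.map_append, List.map_cons, List.map_cons, Equiv.swap_apply_left, hsA, hsB,
        Equiv.swap_apply_of_ne_of_ne (by simp) (by simp)]
    have hxm : (x, !o') ∈ A' ++ B' := by
      have := h.paired x o' (by simp)
      simpa [hxy] using this
    have hym : (y, o') ∈ A' ++ B' := by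
      have := h.paired y (!o') (by simp)
      simpa [Ne.symm hxy] using this
    have hry : r y = x := by simp [r]
    have hrx : r x = x := by simp [r]
    have hne : ∀ a, a ∈ A'.map (Prod.map r id) ∨ a ∈ B'.map (Prod.map r id) → a.1 ≠ y := by
      simp only [List.mem_map]
      have h3 : ∀ j, r j ≠ y := fun j => by
        by_cases hj : j = y
        · rwa [hj, hry]
        · simp [r, hj]
      rintro a (⟨b, -, rfl⟩ | ⟨b, -, rfl⟩) <;> exact h3 _
    have hxU : x ∈ birthLabels w' := h.mem_birthLabels _ (show (x, o') ∈ _ by simp)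
    have hyU : y ∈ birthLabels w' := h.mem_birthLabels _ (show (y, !o') ∈ _ by simp)
    have hU : birthLabels (w'.map (Prod.map id (Piece.map r)) ++ [(A.length, .death)]) =
        (birthLabels w').erase y := by
      rw [birthLabels_append, birthLabels_map]
      refine (Finset.union_empty _).trans ?_
      ext j
      rw [Finset.mem_image, Finset.mem_erase]
      constructor
      · rintro ⟨k, hk, rfl⟩
        by_cases hky : k = y
        · rw [hky, hry]
          exact ⟨hxy, hxU⟩
        · simpa [r, hky] using hk
      · rintro ⟨hj, hjU⟩
        exact ⟨j, hjU, by simp [r, hj]⟩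
    refine ⟨w'.map (Prod.map id (Piece.map r)) ++ [(A.length, .death)],
      A'.map (Prod.map r id) ++ B'.map (Prod.map r id), ?_, ?_, ?_, ?_, ?_, ?_, ?_⟩
    · have h3 := run_map r h.run_eq
      rw [List.map_nil] at h3
      rw [run_append, h3, Option.bind_some]
      have h4 := run_cons_of_acts (.death x o') (A'.map (Prod.map r id)) (B'.map (Prod.map r id))
        (i := A.length) (by rw [← hA]; simp) []
      simpa [hrx, hry, run] using h4
    · rw [List.map_append, List.map_map]
      conv_rhs => rw [← h.map_word]
      congr 1
      refine List.map_congr_left fun e _ => ?_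
      rcases e with ⟨i, _ | _ | _⟩ <;> simp [Piece.map, hr]
    · have h3 : ∀ D : Level (ι × ℕ), (D.map (Prod.map r id)).map (Prod.map Prod.fst id) =
          D.map (Prod.map Prod.fst id) := fun D => by
        rw [List.map_map]
        exact List.map_congr_left fun a _ => Prod.ext (hr a.1) rfl
      rw [List.map_append, h3, h3, hA, hB]
    · have h3 := hn.map (Equiv.swap (x, o') (y, o')).injective
      rw [hτ] at h3
      exact h3.sublist
        (((List.sublist_cons_self _ _).trans (List.sublist_cons_self _ _)).append_left _)
    · rw [← List.map_append]
      intro l b hl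
      obtain ⟨⟨j, b⟩, hj, he⟩ := List.mem_map.1 hl
      simp only [Prod.map_apply, id, Prod.mk.injEq] at he
      obtain ⟨rfl, rfl⟩ := he
      by_cases hjx : r j = x
      · rw [hjx]
        rcases bool_eq_or b o' with rfl | rfl
        · exact List.mem_map.2 ⟨_, hxm, by simp [hrx]⟩
        · exact List.mem_map.2 ⟨_, hym, by simp [hry]⟩
      · have hjy : j ≠ y := fun he => hjx (by rw [he, hry])
        have hj' : r j = j := by simp [r, hjy]
        rw [hj'] at hjx ⊢
        have h3 := h.paired j b
        simp only [List.mem_append, List.mem_cons, Prod.mk.injEq, hjx, hjy, false_and,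
          false_or] at h3 hj
        exact List.mem_map.2 ⟨_, List.mem_append.2 (h3 hj), by simp [hj']⟩
    · rw [hU, ← List.map_append]
      intro a ha
      refine Finset.mem_erase.2 ⟨hne a (by rwa [List.map_append, List.mem_append] at ha), ?_⟩
      obtain ⟨b, hb, rfl⟩ := List.mem_map.1 ha
      by_cases hby : b.1 = y
      · simpa [hby, hry] using hxU
      · have h3 : b ∈ A' ++ (x, o') :: (y, !o') :: B' := by
          simp only [List.mem_append, List.mem_cons] at hb ⊢
          tauto
        simpa [r, hby] using h.mem_birthLabels b h3
    · have h3 := inversions_map_swap (μ := strandWeight m) strandKey_injective hn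
        (x := (x, o')) (y := (y, o')) (by simpa using hxy) (by simp)
        (by simp only [List.mem_append, List.mem_cons] at hym ⊢; tauto)
        (by simp [strandWeight, hx, hy])
      rw [hτ, inversions_label_pair _ _ _ hne] at h3
      have h4 := Finset.add_sum_erase (birthLabels w') (fun l => m l.1) hyU
      simp only [strandWeight, hx, hy] at h3 h4
      rw [hU, weight_append _ _ hw, h2]
      simp only [Piece.weight, weight, List.map_append, List.sum_append]
      cases o' <;> simp at h1 h3 ⊢
      · linear_combination h1 + h3 + h4 - h5
      · linear_combination h1 + h3 + h4

theorem exists_isRefinement (m : ι → ZMod 2) {w : Word ι} {S : Level ι} (h : run [] w = some S) :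
    ∃ w' S', IsRefinement m w S w' S' := by
  induction w using List.reverseRecOn generalizing S with
  | nil =>
    obtain rfl : [] = S := by simpa [run] using h
    exact ⟨[], [], rfl, rfl, rfl, List.nodup_nil, by simp, by simp,
      by simp [weight, inversions, birthLabels]⟩
  | append_singleton w e ih =>
    obtain ⟨i, g⟩ := e
    obtain ⟨R, hR, hs⟩ := run_append_eq_some.1 h
    rw [run_singleton] at hs
    obtain ⟨A, I, O, B, rfl, rfl, hg, rfl⟩ := exists_of_step hs
    obtain ⟨w', S', h'⟩ := ih hR
    cases hg with
    | birth c o => exact h'.birth hR c o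
    | death c o => exact h'.death hR
    | cross b a a' => exact h'.cross hR b

end Refinement

/-- Whitney's formula modulo `2`: the turning number of a closed curve and its number of
self-crossings have different parities. -/
theorem Link.weight_word {L : ℕ} (K : Link L) (m : Fin L → ZMod 2) :
    weight m 1 [] K.word = ∑ c, m c := by
  obtain ⟨w', S', h⟩ := exists_isRefinement m K.closed
  have hS : S' = [] := List.map_eq_nil_iff.1 h.map_level
  have h1 := h.weight_eq
  subst hS
  simp only [inversions, List.map_nil, List.sum_nil, add_zero] at h1
  have h2 : ∑ l ∈ birthLabels w', m l.1 = ∑ c, m c := by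
    refine Finset.sum_bij (fun l _ => l.1) (fun l _ => Finset.mem_univ _) ?_ ?_ fun l _ => rfl
    · rintro ⟨c, n⟩ hn ⟨c', n'⟩ hn' he
      obtain rfl : c = c' := he
      obtain ⟨i, o, hi⟩ := mem_birthLabels.1 hn
      obtain ⟨j, p, hj⟩ := mem_birthLabels.1 hn'
      -- If a number carried two refined labels, separating the label `(c, n)` from all others would
      -- be a consistent division that is not constant on `c`.
      have h3 := K.connected (w'.map (Prod.map id (Piece.map fun l => (l.1, decide (l.2 = n)))))
        (run_map _ h.run_eq) (by
          rw [List.map_map]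
          conv_rhs => rw [← h.map_word]
          refine List.map_congr_left fun e _ => ?_
          rcases e with ⟨i, _ | _ | _⟩ <;> rfl) c true (decide (n' = n)) i j o p
        (List.mem_map.2 ⟨_, hi, by simp [Piece.map]⟩) (List.mem_map.2 ⟨_, hj, by simp [Piece.map]⟩)
      have h4 : n' = n := by simpa using h3.symm
      rw [h4]
    · intro c _
      obtain ⟨i, o, hi⟩ := K.occurs c
      have h3 : c ∈ birthLabels K.word := mem_birthLabels.2 ⟨i, o, hi⟩
      rw [← h.map_word, birthLabels_map] at h3
      obtain ⟨l, hl, rfl⟩ := Finset.mem_image.1 h3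
      exact ⟨l, hl, rfl⟩
  rw [h2] at h1
  exact CharTwo.add_eq_zero.1 h1

/-! ### The monoid of diagram pieces modulo exchange -/

/-- Two pieces of diagrams are identified if they may be exchanged in all diagrams without a change
of the ends or of the value of `H`. -/
def exchangeCon (H : Diagram → Scalars) : Con (FreeMonoid (ℕ × Piece Unit)) where
  r w w' := (∀ S, run S w.toList = run S w'.toList) ∧
    ∀ x y, H (x ++ w.toList ++ y) = H (x ++ w'.toList ++ y)
  iseqv := ⟨fun _ => ⟨fun _ => rfl, fun _ _ => rfl⟩,
    fun h => ⟨fun S => (h.1 S).symm, fun x y => (h.2 x y).symm⟩,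
    fun h h' => ⟨fun S => (h.1 S).trans (h'.1 S), fun x y => (h.2 x y).trans (h'.2 x y)⟩⟩
  mul' := by
    rintro w x y z ⟨h1, h2⟩ ⟨h3, h4⟩
    refine ⟨fun S => ?_, fun a b => ?_⟩
    · simp only [FreeMonoid.toList_mul, run_append, h1, h3]
    · have e1 := h2 a (y.toList ++ b)
      have e2 := h4 (a ++ x.toList) b
      simp only [FreeMonoid.toList_mul, List.append_assoc] at e1 e2 ⊢
      rw [e1, e2]

section Classes

variable (H : Diagram → Scalars)

/-- The class of a piece of a diagram. -/
def cls (w : Diagram) : (exchangeCon H).Quotient := (FreeMonoid.ofList w : FreeMonoid _)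

variable {H}

theorem cls_append (w w' : Diagram) : cls H (w ++ w') = cls H w * cls H w' := rfl

theorem cls_cons (e : ℕ × Piece Unit) (w : Diagram) : cls H (e :: w) = cls H [e] * cls H w := rfl

/-- The value of `H` on a class. -/
def value (q : (exchangeCon H).Quotient) : Scalars :=
  Con.liftOn q (fun w => H w.toList) fun w w' h => by simpa using h.2 [] []

theorem value_cls (w : Diagram) : value (cls H w) = H w := rfl

variable (H) in
/-- A crossing. -/
def cr (i : ℕ) (b : Bool) : (exchangeCon H).Quotient := cls H [(i, .cross b)]

variable (H) in
/-- A local minimum. -/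
def cup (i : ℕ) (o : Bool) : (exchangeCon H).Quotient := cls H [(i, .birth () o)]

variable (H) in
/-- A local maximum. -/
def cap (i : ℕ) : (exchangeCon H).Quotient := cls H [(i, .death)]

variable (hH : IsFramedHomfly H)

include hH

/-- Equal effects on all levels ensure that both completed words are closed or neither is; in the
latter case both values are 0. -/
theorem cls_eq_of_move {m m' : Diagram} (h : Move m m') (hr : ∀ S, run S m = run S m') :
    cls H m = cls H m' := by
  refine (Con.eq _).2 ⟨hr, fun x y => ?_⟩
  simp only [FreeMonoid.toList_ofList]
  have hc : Closed (x ++ m ++ y) ↔ Closed (x ++ m' ++ y) := by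
    unfold Closed
    simp only [run_append]
    rw [funext hr]
  by_cases h1 : Closed (x ++ m ++ y)
  · exact hH.move x y m m' h h1 (hc.1 h1)
  · rw [hH.eq_zero _ h1, hH.eq_zero _ fun h2 => h1 (hc.2 h2)]

theorem cls_interchange (i k : ℕ) (g h : Piece Unit) (hik : i ≤ k) :
    cls H [(i, g)] * cls H [(k + g.outputs, h)] = cls H [(k + g.inputs, h)] * cls H [(i, g)] :=
  cls_eq_of_move hH (.interchange i k g h hik) (run_interchange hik)

theorem commute_cr_right {i j : ℕ} (h : i + 2 ≤ j) (b : Bool) (g : Piece Unit) :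
    Commute (cr H i b) (cls H [(j, g)]) := by
  obtain ⟨k, rfl⟩ := Nat.exists_eq_add_of_le' h
  exact cls_interchange hH i (k + i) (.cross b) g (by omega)

theorem commute_cr_cr {i j : ℕ} (h : i + 2 ≤ j ∨ j + 2 ≤ i) (b b' : Bool) :
    Commute (cr H i b) (cr H j b') := by
  rcases h with h | h
  · exact commute_cr_right hH h b (.cross b')
  · exact (commute_cr_right hH h b' (.cross b)).symm

theorem semiconjBy_cup {i k : ℕ} (h : i ≤ k) (b o : Bool) :
    SemiconjBy (cup H i o) (cr H (k + 2) b) (cr H k b) :=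
  cls_interchange hH i k (.birth () o) (.cross b) h

theorem semiconjBy_cap {i k : ℕ} (h : i ≤ k) (b : Bool) :
    SemiconjBy (cap H i) (cr H k b) (cr H (k + 2) b) :=
  cls_interchange hH i k .death (.cross b) h

theorem cup_mul_cr (i : ℕ) (o b : Bool) :
    cup H i o * cr H (i + 1) b = cup H (i + 1) o * cr H i (!b) :=
  cls_eq_of_move hH (.slide_birth i o b) fun S => run_slide_birth S i o b (!b)

theorem cr_mul_cap (i : ℕ) (b : Bool) :
    cr H i b * cap H (i + 1) = cr H (i + 1) (!b) * cap H i :=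
  cls_eq_of_move hH (.slide_death i b) fun S => run_slide_death S i b (!b)

theorem cr_mul_cr_mul_cr (i : ℕ) {b₁ b₂ b₃ : Bool} (h : ¬ (b₁ = b₃ ∧ b₂ ≠ b₁)) :
    cr H i b₁ * cr H (i + 1) b₂ * cr H i b₃ =
      cr H (i + 1) b₃ * cr H i b₂ * cr H (i + 1) b₁ :=
  cls_eq_of_move hH (.reidemeister_three i b₁ b₂ b₃ h)
    fun S => run_reidemeister_three S i b₁ b₂ b₃ b₃ b₂ b₁

/-- Both sides equal two minima side by side whose inner legs cross: sliding the strand of either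
minimum past the other one changes the nested picture into this one. -/
theorem cup_mul_cup_mul_cr (i : ℕ) (o b : Bool) :
    cup H i o * cup H (i + 1) o * cr H i b = cup H i o * cup H (i + 1) o * cr H (i + 2) b := by
  have h1 := cup_mul_cr hH i o (!b)
  have h2 := cup_mul_cr hH (i + 1) o b
  have h3 : cup H i o * cup H (i + 2) o = cup H i o * cup H i o :=
    cls_interchange hH i i (.birth () o) (.birth () o) le_rfl
  rw [Bool.not_not] at h1
  rw [mul_assoc, ← h1, mul_assoc, h2, ← mul_assoc, ← mul_assoc, h3]

theorem cr_mul_cap_mul_cap (i : ℕ) (b : Bool) :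
    cr H i b * cap H (i + 1) * cap H i = cr H (i + 2) b * cap H (i + 1) * cap H i := by
  have h1 := cr_mul_cap hH i b
  have h2 := cr_mul_cap hH (i + 1) (!b)
  have h3 : cap H i * cap H i = cap H (i + 2) * cap H i :=
    cls_interchange hH i i .death .death le_rfl
  rw [Bool.not_not] at h2
  rw [h1, ← h2, mul_assoc, mul_assoc, h3]

/-! ### Cables -/

theorem commute_cr_cls_cross {i : ℕ} {b : Bool} {w : Diagram}
    (hw : ∀ e ∈ w, (i + 2 ≤ e.1 ∨ e.1 + 2 ≤ i) ∧ ∃ b', e.2 = .cross b') :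
    Commute (cr H i b) (cls H w) := by
  induction w with
  | nil => exact Commute.one_right _
  | cons e w ih =>
    rw [cls_cons]
    obtain ⟨h1, b', h2⟩ := hw e (by simp)
    obtain ⟨j, g⟩ := e
    obtain rfl : g = .cross b' := h2
    exact (commute_cr_cr hH h1 b b').mul_right (ih fun e he => hw e (by simp [he]))

theorem commute_cr_left {i : ℕ} {b : Bool} {w : Diagram} (hw : ∀ e ∈ w, i + 2 ≤ e.1) :
    Commute (cr H i b) (cls H w) := by
  induction w with
  | nil => exact Commute.one_right _
  | cons e w ih =>
    rw [cls_cons]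
    exact (commute_cr_right hH (hw e (by simp)) b e.2).mul_right
      (ih fun e he => hw e (by simp [he]))

theorem commute_cr_braid {i off n : ℕ} {b : Bool} {p : List ℕ} (hp : Fits n p)
    (h : i + 2 ≤ off ∨ off + n ≤ i) : Commute (cr H i b) (cls H (braid off p)) := by
  refine commute_cr_cls_cross hH fun e he => ?_
  obtain ⟨k, hk, rfl⟩ := List.mem_map.1 he
  have := hp k hk
  exact ⟨by dsimp only; omega, _, rfl⟩

theorem commute_cr_crossRow {i off n : ℕ} {b b' : Bool} (h : i + 2 ≤ off ∨ off + n + 1 ≤ i) :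
    Commute (cr H i b) (cls H (crossRow off n b')) := by
  refine commute_cr_cls_cross hH fun e he => ?_
  obtain ⟨k, hk, rfl⟩ := List.mem_map.1 he
  have := List.mem_range.1 hk
  exact ⟨by dsimp only; omega, _, rfl⟩

theorem commute_cr_crossGrid {i off n n' : ℕ} {b b' : Bool}
    (h : i + 2 ≤ off ∨ off + n + n' ≤ i) :
    Commute (cr H i b) (cls H (crossGrid off n n' b')) := by
  induction n with
  | zero => exact Commute.one_right _
  | succ n ih =>
    rw [crossGrid_succ, cls_append]
    exact (commute_cr_crossRow hH (by omega)).mul_right (ih (by omega))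

theorem commute_cr_cups {i off n : ℕ} {b o : Bool} (h : i + 2 ≤ off) :
    Commute (cr H i b) (cls H (cups off n o)) := by
  refine commute_cr_left hH fun e he => ?_
  obtain ⟨k, -, rfl⟩ := List.mem_map.1 he
  dsimp only
  omega

theorem commute_cr_caps {i off n : ℕ} {b : Bool} (h : i + 2 ≤ off) :
    Commute (cr H i b) (cls H (caps off n)) := by
  refine commute_cr_left hH fun e he => ?_
  obtain ⟨k, -, rfl⟩ := List.mem_map.1 he
  dsimp only
  omega

theorem semiconjBy_cups {k off : ℕ} (n : ℕ) {b o : Bool} (h : off ≤ k) :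
    SemiconjBy (cls H (cups off n o)) (cr H (k + 2 * n) b) (cr H k b) := by
  induction n with
  | zero => exact SemiconjBy.one_left _
  | succ n ih =>
    rw [cups_succ, cls_append]
    exact ih.mul_left (semiconjBy_cup hH (k := k + 2 * n) (by omega) b o)

theorem semiconjBy_caps {k off : ℕ} (n : ℕ) {b : Bool} (h : off ≤ k) :
    SemiconjBy (cls H (caps off n)) (cr H k b) (cr H (k + 2 * n) b) := by
  induction n with
  | zero => exact SemiconjBy.one_left _
  | succ n ih =>
    rw [caps_succ, cls_cons]
    exact (semiconjBy_cap hH (k := k + 2 * n) (by omega) b).mul_left ih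

/-- A crossing on the left legs of a nest of minima slides through to the mirror position on the
right legs. Minima nested inside the two strands involved are passed by far commutation, which
reduces to the case where these strands are the two innermost. -/
theorem cups_mul_cr {a n off : ℕ} (h : a + 1 < n) {b o : Bool} :
    cls H (cups off n o) * cr H (off + a) b
      = cls H (cups off n o) * cr H (off + 2 * n - 2 - a) b := by
  induction n with
  | zero => omega
  | succ n ih =>
    rw [cups_succ, cls_append]
    change _ * cup H (off + n) o * _ = _ * cup H (off + n) o * _
    obtain h1 | rfl : a + 1 < n ∨ n = a + 1 := by omega
    · have h2 := (commute_cr_right hH (i := off + a) (j := off + n) (by omega) b (.birth () o)).eq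
      change _ * cup H (off + n) o = cup H (off + n) o * _ at h2
      have h3 := (semiconjBy_cup hH (i := off + n) (k := off + 2 * n - 2 - a) (by omega) b o).eq
      rw [mul_assoc, ← h2, ← mul_assoc, ih h1, mul_assoc, ← h3, mul_assoc]
      congr 3
      omega
    · have h2 := cup_mul_cup_mul_cr hH (off + a) o b
      rw [cups_succ, cls_append]
      change cls H (cups off a o) * cup H (off + a) o * _ * _ =
        cls H (cups off a o) * cup H (off + a) o * _ * _
      rw [mul_assoc, mul_assoc, ← mul_assoc (cup H (off + a) o), ← add_assoc, h2]
      simp only [mul_assoc]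
      congr 4
      omega

theorem cr_mul_caps {a n off : ℕ} (h : a + 1 < n) {b : Bool} :
    cr H (off + a) b * cls H (caps off n)
      = cr H (off + 2 * n - 2 - a) b * cls H (caps off n) := by
  induction n with
  | zero => omega
  | succ n ih =>
    rw [caps_succ, cls_cons]
    change _ * (cap H (off + n) * _) = _ * (cap H (off + n) * _)
    obtain h1 | rfl : a + 1 < n ∨ n = a + 1 := by omega
    · have h2 := (commute_cr_right hH (i := off + a) (j := off + n) (by omega) b .death).eq
      change _ * cap H (off + n) = cap H (off + n) * _ at h2
      have h3 := (semiconjBy_cap hH (i := off + n) (k := off + 2 * n - 2 - a) (by omega) b).eq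
      rw [← mul_assoc, h2, mul_assoc, ih h1, ← mul_assoc, h3, mul_assoc]
      congr 2
      omega
    · have h2 := cr_mul_cap_mul_cap hH (off + a) b
      rw [caps_succ, cls_cons]
      change _ * (_ * (cap H (off + a) * _)) = _ * (_ * (cap H (off + a) * _))
      simp only [← mul_assoc] at h2 ⊢
      rw [← add_assoc, h2]
      congr 4
      omega

/-- The third Reidemeister move: the transverse strand lies above both strands of the crossing or
below both, so the excluded cyclic configuration does not arise. -/
theorem semiconjBy_crossRow {a n off : ℕ} (h : a + 1 < n) {b : Bool} :
    SemiconjBy (cls H (crossRow off n b)) (cr H (off + a) true) (cr H (off + a + 1) true) := by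
  induction n with
  | zero => omega
  | succ n ih =>
    rw [crossRow_succ, cls_append]
    obtain h1 | rfl : a + 1 < n ∨ n = a + 1 := by omega
    · exact (ih h1).mul_left (commute_cr_cr hH (by omega) _ _)
    · rw [crossRow_succ, cls_append, mul_assoc]
      have h2 : SemiconjBy (cr H (off + a) b * cr H (off + a + 1) b) (cr H (off + a) true)
          (cr H (off + a + 1) true) := by
        have := cr_mul_cr_mul_cr hH (off + a) (b₁ := b) (b₂ := b) (b₃ := true) (by simp)
        rw [SemiconjBy, this, mul_assoc]
      exact SemiconjBy.mul_left (commute_cr_crossRow hH (by omega)).symm h2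

theorem semiconjBy_crossGrid_right {a n' off : ℕ} (n : ℕ) (h : a + 1 < n') {b : Bool} :
    SemiconjBy (cls H (crossGrid off n n' b)) (cr H (off + a) true)
      (cr H (off + n + a) true) := by
  induction n with
  | zero => exact SemiconjBy.one_left _
  | succ n ih =>
    rw [crossGrid_succ, cls_append]
    rw [show off + (n + 1) + a = off + n + a + 1 by omega]
    exact (semiconjBy_crossRow hH (off := off + n) h (b := b)).mul_left ih

/-- Two strands traverse a bundle and their mutual crossing is carried along. The factors are
regrouped by far commutation so that both strands cross the last strand of the bundle consecutively,
where the third move applies. -/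
theorem semiconjBy_crossRow_crossRow (off n : ℕ) {b : Bool} :
    SemiconjBy (cls H (crossRow (off + 1) n b) * cls H (crossRow off n b))
      (cr H (off + n) true) (cr H off true) := by
  induction n with
  | zero => exact SemiconjBy.one_left _
  | succ n ih =>
    have h1 := (commute_cr_crossRow hH (i := off + 1 + n) (off := off) (n := n) (b := b) (b' := b)
      (by omega)).eq
    have h2 : SemiconjBy (cr H (off + n + 1) b * cr H (off + n) b) (cr H (off + n + 1) true)
        (cr H (off + n) true) := by
      have := cr_mul_cr_mul_cr hH (off + n) (b₁ := true) (b₂ := b) (b₃ := b) (by simp)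
      rw [SemiconjBy, ← this, mul_assoc]
    rw [crossRow_succ, crossRow_succ, cls_append, cls_append]
    have h3 : cls H (crossRow (off + 1) n b) * cr H (off + 1 + n) b *
        (cls H (crossRow off n b) * cr H (off + n) b) =
        cls H (crossRow (off + 1) n b) * cls H (crossRow off n b) *
          (cr H (off + n + 1) b * cr H (off + n) b) := by
      rw [mul_assoc, ← mul_assoc (cr H (off + 1 + n) b), h1]
      simp only [mul_assoc, add_right_comm]
    change SemiconjBy (_ * cr H (off + 1 + n) b * (_ * cr H (off + n) b)) _ _
    rw [h3]
    exact ih.mul_left h2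

theorem semiconjBy_crossGrid_left {a n off : ℕ} (n' : ℕ) (h : a + 1 < n) {b : Bool} :
    SemiconjBy (cls H (crossGrid off n n' b)) (cr H (off + n' + a) true)
      (cr H (off + a) true) := by
  induction n with
  | zero => omega
  | succ n ih =>
    rw [crossGrid_succ, cls_append]
    obtain h1 | rfl : a + 1 < n ∨ n = a + 1 := by omega
    · exact SemiconjBy.mul_left (commute_cr_crossRow hH (by omega)).symm (ih h1)
    · rw [crossGrid_succ, cls_append, ← mul_assoc, add_right_comm off n' a, ← add_assoc]
      exact (semiconjBy_crossRow_crossRow hH (off + a) n').mul_left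
        (commute_cr_crossGrid hH (by omega)).symm

end Classes

/-! ### Carrying a crossing around a component -/

section Markers

variable {ι : Type} [DecidableEq ι]

/-- The position, among `n` parallel strands with the given orientation, of a crossing that is at
the position `k` when it is seen along the strands. -/
def markerOffset (n k : ℕ) (o : Bool) : ℕ := if o then k else n - 2 - k

/-- The positions at which a crossing of the strands `k` and `k + 1` of a cable of `c` may be
placed in a level of the satellite. -/
def markers (m : ι → ℕ) (c : ι) (k : ℕ) : ℕ → Level ι → List ℕ
  | _, [] => []
  | off, a :: S =>
    (if a.1 = c then [off + markerOffset (m c) k a.2] else []) ++ markers m c k (off + m a.1) S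

variable {m : ι → ℕ} {c : ι} {k : ℕ}

theorem markerOffset_lt {n : ℕ} (hk : k + 1 < n) (o : Bool) : markerOffset n k o + 1 < n := by
  unfold markerOffset
  split_ifs <;> omega

theorem markers_append (off : ℕ) (A B : Level ι) :
    markers m c k off (A ++ B)
      = markers m c k off A ++ markers m c k (off + (expand m A).length) B := by
  induction A generalizing off with
  | nil => simp [markers, expand_nil]
  | cons a A ih => simp [markers, ih, expand_cons, add_assoc]

theorem mem_markers (hk : k + 1 < m c) {off j : ℕ} {S : Level ι} (h : j ∈ markers m c k off S) :
    off ≤ j ∧ j + 2 ≤ off + (expand m S).length := by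
  induction S generalizing off with
  | nil => simp [markers] at h
  | cons a S ih =>
    simp only [markers, List.mem_append] at h
    simp only [expand_cons, List.length_append, List.length_replicate]
    rcases h with h | h
    · split_ifs at h with ha
      · have := markerOffset_lt hk a.2
        rw [List.mem_singleton] at h
        rw [ha]
        omega
      · simp at h
    · have := ih h
      omega

theorem markers_add (off n : ℕ) (S : Level ι) :
    markers m c k (off + n) S = (markers m c k off S).map (· + n) := by
  induction S generalizing off with
  | nil => rfl
  | cons a S ih =>
    simp only [markers, List.map_append, add_right_comm off n, ih]
    split_ifs <;> simp

theorem markers_eq_nil {off : ℕ} {S : Level ι} (h : ∀ a ∈ S, a.1 ≠ c) :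
    markers m c k off S = [] := by
  induction S generalizing off with
  | nil => rfl
  | cons a S ih =>
    rw [markers, if_neg (h a (by simp)), ih fun b hb => h b (by simp [hb])]
    rfl

/-- Only the braids whose labels have not occurred yet are inserted. -/
theorem satelliteFrom_congr {p p' : ι → List ℕ} {S T : Level ι} {w : Word ι}
    (h : run S w = some T) {done : List ι} (hp : ∀ d, d ∉ done → p d = p' d) :
    satelliteFrom m p done S w = satelliteFrom m p' done S w := by
  induction w generalizing S done with
  | nil => rfl
  | cons e w ih =>
    obtain ⟨i, g⟩ := e
    obtain ⟨R, hR, hw⟩ := run_cons_eq_some.1 h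
    obtain ⟨A, I, O, B, rfl, rfl, hg, rfl⟩ := exists_of_step hR
    cases hg with
    | birth d o =>
      simp only [List.cons_append, List.nil_append] at hw ⊢
      rw [satelliteFrom_birth, satelliteFrom_birth,
        ih hw fun x hx => hp x fun hx' => hx (List.mem_cons_of_mem _ hx')]
      split_ifs with hd
      · rfl
      all_goals rw [hp d hd]
    | death d o =>
      simp only [List.cons_append, List.nil_append] at hw ⊢
      rw [satelliteFrom_death, satelliteFrom_death, ih hw hp]
    | cross b a a' =>
      simp only [List.cons_append, List.nil_append] at hw ⊢
      rw [satelliteFrom_cross, satelliteFrom_cross, ih hw hp]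

variable {H : Diagram → Scalars}

/-- Inserting the crossing below `P` at `j` or above it at `f j` gives the same value, so counts
over corresponding positions agree. -/
theorem countP_markers_congr {l l' : List ℕ} {f : ℕ → ℕ} {P q r : (exchangeCon H).Quotient}
    {φ : Scalars → Bool} (hl : l' = l.map f)
    (hf : ∀ j ∈ l, SemiconjBy P (cr H (f j) true) (cr H j true)) :
    l.countP (fun j => φ (value (q * (cr H j true * (P * r))))) =
      l'.countP fun j => φ (value (q * P * (cr H j true * r))) := by
  rw [hl, List.countP_map]
  refine List.countP_congr fun j hj => ?_
  have := (hf j hj).eq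
  have e : q * (cr H j true * (P * r)) = q * P * (cr H (f j) true * r) := by
    rw [← mul_assoc (cr H j true), ← this]
    simp only [mul_assoc]
  simp [e]

variable (hH : IsFramedHomfly H)

include hH

/-- The ends of the strands labelled `c` are joined in pairs by the part of the diagram above a
level, and a crossing on the cable of `c` may be moved from one end to the other. -/
theorem even_countP_markers {p : ι → List ℕ} (hp : ∀ c, Fits (m c) (p c))
    (hk : k + 1 < m c) (φ : Scalars → Bool) {S : Level ι} {w : Word ι} (h : run S w = some [])
    {done : List ι} (hc : c ∈ done) (q : (exchangeCon H).Quotient) :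
    Even ((markers m c k 0 S).countP fun j =>
      φ (value (q * (cr H j true * cls H (satelliteFrom m p done S w))))) := by
  induction w generalizing S done q with
  | nil =>
    obtain rfl : S = [] := by simpa [run] using h
    simp [markers]
  | cons e w ih =>
    obtain ⟨i, g⟩ := e
    obtain ⟨R, hR, hw⟩ := run_cons_eq_some.1 h
    obtain ⟨A, I, O, B, rfl, rfl, hg, rfl⟩ := exists_of_step hR
    have hA : ∀ j ∈ markers m c k 0 A, j + 2 ≤ (expand m A).length := fun j hj => by
      simpa using (mem_markers hk hj).2
    have hB : ∀ {off j}, j ∈ markers m c k off B → off ≤ j := fun hj => (mem_markers hk hj).1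
    cases hg with
    | birth d o =>
      rw [List.nil_append, satelliteFrom_birth, cls_append]
      set P := cls H (cups (expand m A).length (m d) o ++ if d ∈ done then [] else
        braid (if o then (expand m A).length else (expand m A).length + m d) (p d)) with hP
      simp only [List.cons_append, List.nil_append] at hw
      have h1 := ih hw (done := d :: done) (by simp [hc]) (q * P)
      simp only [markers_append, markers, List.countP_append, zero_add] at h1 ⊢
      have hA' := countP_markers_congr (H := H) (q := q) (l := markers m c k 0 A)
        (l' := markers m c k 0 A) (f := id) (P := P)
        (r := cls H (satelliteFrom m p (d :: done) (A ++ (d, o) :: (d, !o) :: B) w))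
        (φ := φ) (by simp) ?_
      have hB' := countP_markers_congr (H := H) (q := q) (l := markers m c k (expand m A).length B)
        (l' := markers m c k ((expand m A).length + m d + m d) B) (f := (· + 2 * m d)) (P := P)
        (r := cls H (satelliteFrom m p (d :: done) (A ++ (d, o) :: (d, !o) :: B) w))
        (φ := φ) (by rw [add_assoc, ← two_mul, markers_add]) ?_
      · rw [hA', hB']
        split_ifs at h1 with hd
        · subst hd
          -- The level above has two extra markers, one on each leg of the new nest of minima. They
          -- give the same value, because a crossing slides through the nest, so together they
          -- contribute 0 or 2. No braid intervenes, since `c` is already in `done`.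
          have h2 : P * cr H ((expand m A).length + markerOffset (m d) k o) true =
              P * cr H ((expand m A).length + m d + markerOffset (m d) k (!o)) true := by
            rw [hP, if_pos hc, List.append_nil, cups_mul_cr hH (markerOffset_lt hk o)]
            congr 2
            unfold markerOffset
            cases o <;> simp <;> omega
          simp only [← mul_assoc] at h1 ⊢
          simp only [List.countP_cons] at h1
          rw [mul_assoc q, h2, ← mul_assoc q] at h1
          revert h1
          rw [Nat.even_iff, Nat.even_iff]
          omega
        · simpa using h1
      · intro j hj
        have h2 := mem_markers hk hj
        rw [hP, cls_append]
        refine (semiconjBy_cups hH (m d) h2.1).mul_left ?_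
        split_ifs
        · exact SemiconjBy.one_left _
        all_goals exact (commute_cr_braid hH (hp d) (by omega)).symm
      · intro j hj
        have h2 := hA j hj
        rw [id]
        rw [hP, cls_append]
        refine SemiconjBy.mul_left (commute_cr_cups hH h2).symm ?_
        split_ifs
        · exact SemiconjBy.one_left _
        all_goals exact (commute_cr_braid hH (hp d) (by omega)).symm
    | death d o =>
      simp only [List.cons_append, List.nil_append] at hw ⊢
      rw [satelliteFrom_death, cls_append]
      have h1 := ih hw hc (q * cls H (caps (expand m A).length (m d)))
      simp only [markers_append, markers, List.countP_append, zero_add] at h1 ⊢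
      have hA' := countP_markers_congr (H := H) (q := q) (l := markers m c k 0 A)
        (l' := markers m c k 0 A) (f := id) (P := cls H (caps (expand m A).length (m d)))
        (r := cls H (satelliteFrom m p done (A ++ B) w))
        (φ := φ) (by simp) fun j hj => (commute_cr_caps hH (hA j hj)).symm
      have hB' := countP_markers_congr (H := H) (q := q)
        (l := markers m c k ((expand m A).length + m d + m d) B)
        (l' := markers m c k (expand m A).length B) (f := (· - 2 * m d))
        (P := cls H (caps (expand m A).length (m d)))
        (r := cls H (satelliteFrom m p done (A ++ B) w))
        (φ := φ) ?_ ?_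
      · rw [hA', hB']
        split_ifs with hd
        · subst hd
          -- The two markers that disappear at the nest of maxima give equal values, again by
          -- sliding.
          have h2 : cr H ((expand m A).length + markerOffset (m d) k o) true *
              cls H (caps (expand m A).length (m d)) =
              cr H ((expand m A).length + m d + markerOffset (m d) k (!o)) true *
              cls H (caps (expand m A).length (m d)) := by
            rw [cr_mul_caps hH (markerOffset_lt hk o)]
            congr 2
            unfold markerOffset
            cases o <;> simp <;> omega
          simp only [List.countP_cons, List.countP_nil]
          rw [← mul_assoc (cr H ((expand m A).length + markerOffset (m d) k o) true), h2,
            ← mul_assoc (cr H ((expand m A).length + m d + markerOffset (m d) k (!o)) true)]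
          revert h1
          rw [Nat.even_iff, Nat.even_iff]
          omega
        · simpa using h1
      · rw [add_assoc, ← two_mul, markers_add, List.map_map]
        conv_lhs => rw [← List.map_id (markers m c k (expand m A).length B)]
        exact List.map_congr_left fun j _ => by simp
      · intro j hj
        have h2 := mem_markers hk hj
        have h3 := semiconjBy_caps hH (k := j - 2 * m d) (off := (expand m A).length) (m d)
          (b := true) (by omega)
        rwa [Nat.sub_add_cancel (by omega)] at h3
    | cross b a a' =>
      simp only [List.cons_append, List.nil_append] at hw ⊢
      rw [satelliteFrom_cross, cls_append]
      set P := cls H (crossGrid (expand m A).length (m a.1) (m a'.1) b) with hP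
      have h1 := ih hw hc (q * P)
      simp only [markers_append, markers, List.countP_append, zero_add] at h1 ⊢
      have hA' := countP_markers_congr (H := H) (q := q) (l := markers m c k 0 A)
        (l' := markers m c k 0 A) (f := id) (P := P)
        (r := cls H (satelliteFrom m p done (A ++ a' :: a :: B) w))
        (φ := φ) (by simp)
        fun j hj => (commute_cr_crossGrid hH (Or.inl (hA j hj))).symm
      have hB' := countP_markers_congr (H := H) (q := q)
        (l := markers m c k ((expand m A).length + m a.1 + m a'.1) B)
        (l' := markers m c k ((expand m A).length + m a'.1 + m a.1) B) (f := id) (P := P)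
        (r := cls H (satelliteFrom m p done (A ++ a' :: a :: B) w))
        (φ := φ) (by rw [List.map_id, add_right_comm])
        fun j hj => (commute_cr_crossGrid hH (Or.inr (hB hj))).symm
      have ha := countP_markers_congr (H := H) (q := q)
        (l := if a.1 = c then [(expand m A).length + markerOffset (m c) k a.2] else [])
        (l' := if a.1 = c then [(expand m A).length + m a'.1 + markerOffset (m c) k a.2] else [])
        (f := (· + m a'.1)) (P := P)
        (r := cls H (satelliteFrom m p done (A ++ a' :: a :: B) w))
        (φ := φ) (by split_ifs <;> simp [add_right_comm]) ?_
      have ha' := countP_markers_congr (H := H) (q := q)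
        (l := if a'.1 = c then [(expand m A).length + m a.1 + markerOffset (m c) k a'.2] else [])
        (l' := if a'.1 = c then [(expand m A).length + markerOffset (m c) k a'.2] else [])
        (f := (· - m a.1)) (P := P)
        (r := cls H (satelliteFrom m p done (A ++ a' :: a :: B) w))
        (φ := φ) (by split_ifs <;> simp; omega) ?_
      · rw [hA', hB', ha, ha']
        convert h1 using 1
        ring
      · intro j hj
        split_ifs at hj with hd
        · subst hd
          rw [List.mem_singleton] at hj
          subst hj
          rw [add_right_comm, Nat.add_sub_cancel, ← add_right_comm]
          exact semiconjBy_crossGrid_right hH _ (markerOffset_lt hk _)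
        · simp at hj
      · intro j hj
        split_ifs at hj with hd
        · subst hd
          rw [List.mem_singleton] at hj
          subst hj
          rw [add_right_comm]
          exact semiconjBy_crossGrid_left hH _ (markerOffset_lt hk _)
        · simp at hj

/-- A crossing may be moved along the component `c` around the whole diagram. -/
theorem value_satelliteFrom_rotate {p p' : ι → List ℕ} (hp : ∀ c, Fits (m c) (p c))
    (hpp : ∀ d ≠ c, p' d = p d) {r : List ℕ} (hpc : p c = k :: r) (hpc' : p' c = r ++ [k])
    {S : Level ι} {w : Word ι} (h : run S w = some []) (hS : ∀ a ∈ S, a.1 ≠ c)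
    {done : List ι} (hc : c ∉ done) (q : (exchangeCon H).Quotient) :
    value (q * cls H (satelliteFrom m p done S w)) =
      value (q * cls H (satelliteFrom m p' done S w)) := by
  have hk : k + 1 < m c := hp c k (by simp [hpc])
  have hr : Fits (m c) r := fun j hj => hp c j (by simp [hpc, hj])
  have hp' : ∀ d, Fits (m d) (p' d) := fun d => by
    by_cases hd : d = c
    · subst hd
      rw [hpc']
      intro j hj
      rcases List.mem_append.1 hj with hj | hj
      · exact hr j hj
      · rwa [List.mem_singleton.1 hj]
    · rw [hpp d hd]
      exact hp d
  induction w generalizing S done q with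
  | nil => rfl
  | cons e w ih =>
    obtain ⟨i, g⟩ := e
    obtain ⟨R, hR, hw⟩ := run_cons_eq_some.1 h
    obtain ⟨A, I, O, B, rfl, rfl, hg, rfl⟩ := exists_of_step hR
    have hA : ∀ a ∈ A, a.1 ≠ c := fun a ha => hS a (by simp [ha])
    have hB : ∀ a ∈ B, a.1 ≠ c := fun a ha => hS a (by simp [ha])
    cases hg with
    | birth d o =>
      simp only [List.cons_append, List.nil_append] at hw ⊢
      rw [satelliteFrom_birth, satelliteFrom_birth]
      by_cases hd : d = c
      · subst hd
        rw [if_neg hc, if_neg hc, satelliteFrom_congr hw (p := p) (p' := p')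
          fun x hx => (hpp x (by rintro rfl; simp at hx)).symm, hpc, hpc']
        set off := (expand m A).length with hoff
        set rest := cls H (satelliteFrom m p' (d :: done) (A ++ (d, o) :: (d, !o) :: B) w)
          with hrestdef
        set off' := if o then off else off + m d with hoff'
        have hb1 : cls H (braid off' (k :: r)) = cr H (off' + k) true * cls H (braid off' r) := rfl
        have hb2 : cls H (braid off' (r ++ [k])) = cls H (braid off' r) * cr H (off' + k) true := by
          rw [braid, List.map_append, cls_append]
          rfl
        rw [cls_append, cls_append, cls_append, cls_append, hb1, hb2]
        -- Just above the first minimum of `c` exactly two markers exist. Evenness for every test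
        -- `φ` forces their values to coincide: the indicator of the first value would otherwise be
        -- counted once.
        have heven := fun φ => even_countP_markers hH hp' hk φ hw (done := d :: done) (by simp)
          (q * cls H (cups off (m d) o) * cls H (braid off' r))
        simp only [markers_append, markers, markers_eq_nil hA, markers_eq_nil hB] at heven
        have hval : value (q * cls H (cups off (m d) o) * cls H (braid off' r) *
            (cr H (off + markerOffset (m d) k o) true * rest)) =
          value (q * cls H (cups off (m d) o) * cls H (braid off' r) *
            (cr H (off + m d + markerOffset (m d) k (!o)) true * rest)) := by
          classical
          by_contra hne
          have := heven fun x => decide (x = value (q * cls H (cups off (m d) o) *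
            cls H (braid off' r) * (cr H (off + markerOffset (m d) k o) true * rest)))
          simp [← hoff, ← hrestdef, Ne.symm hne] at this
        have hcup := cups_mul_cr hH (off := off) (markerOffset_lt hk o) (b := true) (o := o)
        have hop : off + 2 * m d - 2 - markerOffset (m d) k o =
            off + m d + markerOffset (m d) k (!o) := by
          unfold markerOffset
          cases o <;> simp <;> omega
        rw [hop] at hcup
        -- A crossing on the leg without the braid commutes with `braid off' r` and slides down
        -- through the minima to the other leg. Together with `hval`, which leads around the rest of
        -- the diagram, this moves the crossing from one end of the braid to the other.
        have hmove : ∀ i j, cls H (cups off (m d) o) * cr H i true =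
            cls H (cups off (m d) o) * cr H j true →
            Commute (cr H i true) (cls H (braid off' r)) →
            q * (cls H (cups off (m d) o) * cls H (braid off' r) * (cr H i true * rest)) =
              q * (cls H (cups off (m d) o) * (cr H j true * cls H (braid off' r)) * rest) := by
          intro i j h1 h2
          rw [← mul_assoc (cls H (cups off (m d) o)) (cr H j true), ← h1,
            mul_assoc _ (cr H i true), h2.eq]
          simp only [mul_assoc]
        have hm := markerOffset_lt hk o
        have hval' : ∀ i, q * cls H (cups off (m d) o) * cls H (braid off' r) *
            (cr H i true * rest) =
            q * (cls H (cups off (m d) o) * cls H (braid off' r) * (cr H i true * rest)) :=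
          fun i => by simp only [mul_assoc]
        rw [hval', hval'] at hval
        rw [← mul_assoc _ (cls H (braid off' r)), mul_assoc (_ * _) (cr H (off' + k) true) rest]
        cases o
        · have e : off' + k = off + m d + markerOffset (m d) k (!false) := by
            simp [off', markerOffset]
          rw [e, ← hval, hmove _ _ hcup (commute_cr_braid hH hr (Or.inl _))]
          simp only [hoff', Bool.false_eq_true, reduceIte]
          omega
        · have e : off' + k = off + markerOffset (m d) k true := by
            simp [off', markerOffset]
          rw [e, hval, hmove _ _ hcup.symm (commute_cr_braid hH hr (Or.inr _))]
          simp only [hoff', reduceIte]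
          omega
      · rw [hpp d hd]
        simp only [cls_append, ← mul_assoc]
        refine ih hw ?_ (done := d :: done) (by simp [hc, Ne.symm hd]) _
        intro a ha
        simp only [List.mem_append, List.mem_cons] at ha
        rcases ha with ha | rfl | rfl | ha
        exacts [hA a ha, hd, hd, hB a ha]
    | death d o =>
      simp only [List.cons_append, List.nil_append] at hw ⊢
      rw [satelliteFrom_death, satelliteFrom_death, cls_append, cls_append, ← mul_assoc,
        ← mul_assoc]
      refine ih hw ?_ hc _
      intro a ha
      rcases List.mem_append.1 ha with ha | ha
      exacts [hA a ha, hB a ha]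
    | cross b a a' =>
      simp only [List.cons_append, List.nil_append] at hw ⊢
      rw [satelliteFrom_cross, satelliteFrom_cross, cls_append, cls_append, ← mul_assoc,
        ← mul_assoc]
      refine ih hw ?_ hc _
      intro x hx
      refine hS x ?_
      simp only [List.mem_append, List.mem_cons, List.not_mem_nil] at hx ⊢
      tauto

end Markers

/-! ### Permutation braids and their inverses -/

section SortWord

theorem fits_sortWord (l : List ℕ) : Fits l.length (sortWord l) := by
  induction l with
  | nil => simp [sortWord, Fits]
  | cons x l ih =>
    intro k hk
    simp only [sortWord, List.mem_append, List.mem_map, List.mem_range] at hk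
    rw [List.length_cons]
    rcases hk with ⟨j, hj, rfl⟩ | hk
    · have := ih j hj
      omega
    · have := hk.trans_le List.countP_le_length
      omega

variable {H : Diagram → Scalars}

variable (H) in
/-- Two positive braid words have the same class at every position. -/
def BraidEq (u u' : List ℕ) : Prop := ∀ off, cls H (braid off u) = cls H (braid off u')

theorem braid_append (off : ℕ) (u u' : List ℕ) :
    braid off (u ++ u') = braid off u ++ braid off u' := List.map_append

theorem braid_map_succ (off : ℕ) (u : List ℕ) :
    braid off (u.map (· + 1)) = braid (off + 1) u := by
  simp [braid, add_assoc, add_comm 1]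

theorem BraidEq.refl (u : List ℕ) : BraidEq H u u := fun _ => rfl

theorem BraidEq.trans {u v w : List ℕ} (h : BraidEq H u v) (h' : BraidEq H v w) : BraidEq H u w :=
  fun off => (h off).trans (h' off)

theorem BraidEq.symm {u v : List ℕ} (h : BraidEq H u v) : BraidEq H v u :=
  fun off => (h off).symm

theorem BraidEq.append {u v u' v' : List ℕ} (h : BraidEq H u v) (h' : BraidEq H u' v') :
    BraidEq H (u ++ u') (v ++ v') := fun off => by
  rw [braid_append, braid_append, cls_append, cls_append, h, h']

theorem BraidEq.map_succ {u v : List ℕ} (h : BraidEq H u v) :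
    BraidEq H (u.map (· + 1)) (v.map (· + 1)) := fun off => by
  rw [braid_map_succ, braid_map_succ, h]

variable (hH : IsFramedHomfly H)

include hH

theorem braidEq_append_zero (u : List ℕ) :
    BraidEq H ((u.map (· + 1)).map (· + 1) ++ [0]) (0 :: (u.map (· + 1)).map (· + 1)) := by
  intro off
  have h := (commute_cr_left hH (i := off) (b := true)
    (w := braid off ((u.map (· + 1)).map (· + 1))) ?_).eq
  · rw [braid_append, cls_append]
    exact h.symm
  · intro e he
    obtain ⟨k, hk, rfl⟩ := List.mem_map.1 he
    simp only [List.map_map, List.mem_map, Function.comp] at hk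
    obtain ⟨j, -, rfl⟩ := hk
    dsimp only
    omega

/-- A permutation braid may be started by moving the strand with the least end to the left. -/
theorem braidEq_sortWord_of_min {a b : List ℕ} {x : ℕ} (ha : ∀ y ∈ a, x < y)
    (hb : ∀ y ∈ b, x < y) :
    BraidEq H (sortWord (a ++ x :: b))
      ((List.range a.length).reverse ++ (sortWord (a ++ b)).map (· + 1)) := by
  induction a with
  | nil =>
    have : b.countP (· < x) = 0 := List.countP_eq_zero.2 fun y hy => by
      have := hb y hy
      simp
      omega
    simp only [List.nil_append, sortWord, this]
    simpa using BraidEq.refl _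
  | cons y a ih =>
    have h1 := ih fun z hz => ha z (by simp [hz])
    have hy := ha y (by simp)
    have hc : (a ++ x :: b).countP (· < y) = (a ++ b).countP (· < y) + 1 := by
      simp only [List.countP_append, List.countP_cons, hy, decide_true, if_true]
      omega
    simp only [List.cons_append, sortWord, hc, List.length_cons]
    -- The leading 0 of the range for `y` is its crossing with the strand of `x`. It commutes to the
    -- left past the doubly shifted word and completes the reversed range.
    rw [List.range_succ_eq_map (n := a.length), List.range_succ_eq_map]
    have h2 := (h1.map_succ).append (BraidEq.refl (H := H)
      (0 :: (List.range ((a ++ b).countP (· < y))).map Nat.succ))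
    refine h2.trans ?_
    have h3 := ((BraidEq.refl (H := H) ((List.range a.length).reverse.map (· + 1))).append
      (braidEq_append_zero hH (sortWord (a ++ b)))).append
      (BraidEq.refl (H := H) ((List.range ((a ++ b).countP (· < y))).map (· + 1)))
    intro off
    have h4 := h3 off
    simp only [List.reverse_cons, List.map_append, List.append_assoc, List.cons_append,
      List.nil_append, List.map_reverse] at h4 ⊢
    exact h4

/-- The permutation braids of a permutation and of its inverse are the reverses of each other. -/
theorem braidEq_sortWord_reverse {α : Type} (f g : α → ℕ) {lf lg : List α} (hl : lf.Perm lg)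
    (hf : lf.Pairwise fun x y => f x < f y) (hg : lg.Pairwise fun x y => g x < g y) :
    BraidEq H (sortWord (lf.map g)) (sortWord (lg.map f)).reverse := by
  induction lg generalizing lf with
  | nil =>
    rw [List.perm_nil.1 hl]
    exact BraidEq.refl _
  | cons x lg ih =>
    obtain ⟨a, b, rfl⟩ := List.append_of_mem (hl.symm.subset List.mem_cons_self)
    have hl' : (a ++ b).Perm lg := (List.perm_middle.symm.trans hl).cons_inv
    have hx : ∀ y ∈ a ++ b, g x < g y := fun y hy =>
      (List.pairwise_cons.1 hg).1 y (hl'.subset hy)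
    have hf' := List.pairwise_append.1 hf
    have hfb := List.pairwise_cons.1 hf'.2.1
    have hab : (a ++ b).Pairwise fun x y => f x < f y :=
      hf.sublist ((List.sublist_cons_self _ _).append_left _)
    have h1 := ih hl' hab (List.pairwise_cons.1 hg).2
    -- Precisely the elements of `a` precede `x` in the order by `f`, so the final range of the
    -- inverse braid is the reverse of the initial part supplied by `braidEq_sortWord_of_min`.
    have hcount : (lg.map f).countP (· < f x) = a.length := by
      rw [← (hl'.map f).countP_eq, List.map_append, List.countP_append,
        List.countP_eq_length.2, List.countP_eq_zero.2, List.length_map, add_zero]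
      · intro y hy
        obtain ⟨z, hz, rfl⟩ := List.mem_map.1 hy
        have := hfb.1 z hz
        simp
        omega
      · intro y hy
        obtain ⟨z, hz, rfl⟩ := List.mem_map.1 hy
        simpa using hf'.2.2 z hz x (by simp)
    have h2 := braidEq_sortWord_of_min hH (a := a.map g) (b := b.map g) (x := g x)
      (by simpa using fun y hy => hx y (by simp [hy])) (by simpa using fun y hy => hx y (by simp [hy]))
    rw [List.map_append, List.map_cons]
    refine h2.trans ?_
    rw [List.map_cons, sortWord, hcount, List.reverse_append, List.length_map, ← List.map_append,
      ← List.map_reverse]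
    exact (BraidEq.refl _).append h1.map_succ

end SortWord

/-! ### Row and column readings of a Young diagram -/

section Reading

variable (A : YoungDiagram)

/-- The cells in the row reading. -/
def rowReading : List (ℕ × ℕ) :=
  (List.range A.rowLens.length).flatMap fun i => (List.range (A.rowLen i)).map fun j => (i, j)

/-- The position of a cell in the column reading. -/
def columnPosition (c : ℕ × ℕ) : ℕ := ((List.range c.2).map A.colLen).sum + c.1

theorem readingWord_eq : readingWord A = sortWord ((rowReading A).map (columnPosition A)) := by
  simp only [readingWord, rowReading, List.map_flatMap, List.map_map]
  rfl

theorem mem_rowReading {c : ℕ × ℕ} : c ∈ rowReading A ↔ c ∈ A := by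
  obtain ⟨i, j⟩ := c
  simp only [rowReading, List.mem_flatMap, List.mem_map, List.mem_range, Prod.mk.injEq,
    YoungDiagram.length_rowLens]
  constructor
  · rintro ⟨i, -, j, hj, rfl, rfl⟩
    exact YoungDiagram.mem_iff_lt_rowLen.2 hj
  · intro h
    refine ⟨i, ?_, j, YoungDiagram.mem_iff_lt_rowLen.1 h, rfl, rfl⟩
    exact YoungDiagram.mem_iff_lt_colLen.1 (A.up_left_mem le_rfl (Nat.zero_le j) h)

theorem sum_map_range_mono (f : ℕ → ℕ) {i j : ℕ} (h : i < j) :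
    ((List.range i).map f).sum + f i ≤ ((List.range j).map f).sum := by
  induction j with
  | zero => omega
  | succ j ih =>
    rw [List.range_succ, List.map_append, List.sum_append]
    simp only [List.map_cons, List.map_nil, List.sum_singleton]
    obtain rfl | h : i = j ∨ i < j := by omega
    · exact le_rfl
    · have := ih h
      omega

/-- Rows are the columns of the transpose, so its column position lists the cells in row order. This
expresses both readings by one kind of position function. -/
theorem pairwise_rowReading :
    (rowReading A).Pairwise fun c d =>
      columnPosition A.transpose c.swap < columnPosition A.transpose d.swap := by
  rw [rowReading, List.pairwise_flatMap]
  refine ⟨fun i _ => ?_, ?_⟩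
  · rw [List.pairwise_map]
    refine List.pairwise_lt_range.imp fun {j k} h => ?_
    simpa [columnPosition] using h
  · refine List.pairwise_lt_range.imp fun {i k} h => ?_
    simp only [List.mem_map, List.mem_range]
    rintro _ ⟨j, hj, rfl⟩ _ ⟨l, -, rfl⟩
    simp only [columnPosition, Prod.fst_swap, Prod.snd_swap]
    have := sum_map_range_mono A.transpose.colLen h
    rw [YoungDiagram.colLen_transpose] at this
    omega

theorem nodup_rowReading : (rowReading A).Nodup :=
  (pairwise_rowReading A).imp fun h he => by simp [he] at h

theorem length_rowReading : (rowReading A).length = A.card := by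
  rw [← List.toFinset_card_of_nodup (nodup_rowReading A), YoungDiagram.card]
  congr 1
  ext c
  simp [mem_rowReading]

theorem card_transpose : A.transpose.card = A.card := by
  simp [YoungDiagram.card, YoungDiagram.transpose]

theorem fits_readingWord : Fits A.card (readingWord A) := by
  have := fits_sortWord ((rowReading A).map (columnPosition A))
  rwa [List.length_map, length_rowReading, ← readingWord_eq] at this

/-- Transposition exchanges the row and column readings, so the two words represent inverse
permutations. -/
theorem braidEq_readingWord {H : Diagram → Scalars} (hH : IsFramedHomfly H) :
    BraidEq H (readingWord A.transpose) (readingWord A).reverse := by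
  have h := braidEq_sortWord_reverse hH (columnPosition A ∘ Prod.swap)
    (columnPosition A.transpose) (lf := rowReading A.transpose)
    (lg := (rowReading A).map Prod.swap) ?_ ?_ ?_
  · rw [readingWord_eq, readingWord_eq]
    rw [List.map_map] at h
    have e : (columnPosition A ∘ Prod.swap) ∘ Prod.swap = columnPosition A := by
      ext; simp
    rwa [e] at h
  · refine (List.perm_ext_iff_of_nodup (nodup_rowReading _)
      ((nodup_rowReading A).map Prod.swap_injective)).2 fun c => ?_
    rw [mem_rowReading, List.mem_map, YoungDiagram.mem_transpose]
    simp only [mem_rowReading]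
    exact ⟨fun h => ⟨_, h, Prod.swap_swap c⟩, by rintro ⟨d, hd, rfl⟩; simpa using hd⟩
  · simpa using pairwise_rowReading A.transpose
  · rw [List.pairwise_map]
    exact pairwise_rowReading A

end Reading

/-! ### Replacing braid words in a satellite -/

section Decorations

variable {ι : Type} [DecidableEq ι] {m : ι → ℕ} {H : Diagram → Scalars}

theorem cls_satelliteFrom_congr {p p' : ι → List ℕ} (hp : ∀ c, BraidEq H (p c) (p' c))
    {S T : Level ι} {w : Word ι} (h : run S w = some T) (done : List ι) :
    cls H (satelliteFrom m p done S w) = cls H (satelliteFrom m p' done S w) := by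
  induction w generalizing S done with
  | nil => rfl
  | cons e w ih =>
    obtain ⟨i, g⟩ := e
    obtain ⟨R, hR, hw⟩ := run_cons_eq_some.1 h
    obtain ⟨A, I, O, B, rfl, rfl, hg, rfl⟩ := exists_of_step hR
    cases hg with
    | birth d o =>
      simp only [List.cons_append, List.nil_append] at hw ⊢
      rw [satelliteFrom_birth, satelliteFrom_birth]
      simp only [cls_append, ih hw]
      split_ifs with hd
      · rfl
      all_goals rw [hp d]
    | death d o =>
      simp only [List.cons_append, List.nil_append] at hw ⊢
      rw [satelliteFrom_death, satelliteFrom_death, cls_append, cls_append, ih hw]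
    | cross b a a' =>
      simp only [List.cons_append, List.nil_append] at hw ⊢
      rw [satelliteFrom_cross, satelliteFrom_cross, cls_append, cls_append, ih hw]

end Decorations

theorem Fits.append {n : ℕ} {u u' : List ℕ} (h : Fits n u) (h' : Fits n u') : Fits n (u ++ u') :=
  fun k hk => (List.mem_append.1 hk).elim (h k) (h' k)

theorem Fits.reverse {n : ℕ} {u : List ℕ} (h : Fits n u) : Fits n u.reverse :=
  fun k hk => h k (List.mem_reverse.1 hk)

theorem fits_permWord {n : ℕ} (π : Equiv.Perm (Fin n)) : Fits n (permWord π) := by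
  have := fits_sortWord (List.ofFn fun i => (π i : ℕ))
  rwa [List.length_ofFn] at this

/-! ### Rotation of decorations and signs of satellites -/

section Link

variable {L : ℕ} (K : Link L) {m : Fin L → ℕ} {H : Diagram → Scalars}

theorem Link.satellite_congr {p p' : Fin L → List ℕ} (hp : ∀ c, BraidEq H (p c) (p' c)) :
    H (K.satellite m p) = H (K.satellite m p') := by
  have := cls_satelliteFrom_congr (m := m) hp K.closed []
  exact congrArg value this

/-- The decoration of a component is determined up to cyclic permutations. -/
theorem Link.satellite_rotate (hH : IsFramedHomfly H) {p p' : Fin L → List ℕ} {c : Fin L}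
    {x y : List ℕ} (hp : ∀ c, Fits (m c) (p c)) (hpp : ∀ d ≠ c, p' d = p d) (hpc : p c = x ++ y)
    (hpc' : p' c = y ++ x) : H (K.satellite m p) = H (K.satellite m p') := by
  induction x generalizing y p with
  | nil =>
    have : p = p' := funext fun d => by
      by_cases hd : d = c
      · subst hd
        simpa [hpc'] using hpc
      · exact (hpp d hd).symm
    rw [this]
  | cons k x ih =>
    have hu : Function.update p c (x ++ (y ++ [k])) c = x ++ (y ++ [k]) :=
      Function.update_self ..
    have hne : ∀ d ≠ c, Function.update p c (x ++ (y ++ [k])) d = p d := fun d hd =>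
      Function.update_of_ne hd ..
    have h1 := value_satelliteFrom_rotate hH (p := p)
      (p' := Function.update p c (x ++ (y ++ [k]))) hp hne (k := k) (r := x ++ y) hpc
      (by rw [hu, List.append_assoc]) K.closed (done := []) (by simp) (by simp) 1
    rw [one_mul, one_mul, value_cls, value_cls] at h1
    refine h1.trans (ih ?_ ?_ hu (by simpa using hpc'))
    · intro d
      by_cases hd : d = c
      · subst hd
        rw [hu]
        have := hp d
        rw [hpc] at this
        intro j hj
        refine this j ?_
        simp only [List.mem_append, List.mem_cons, List.not_mem_nil, or_false] at hj ⊢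
        tauto
      · rw [hne d hd]
        exact hp d
    · intro d hd
      rw [hpp d hd, hne d hd]

/-- The components are rotated one at a time; `s` is the set of those already rotated. -/
theorem Link.satellite_rotate_all (hH : IsFramedHomfly H) {x y : Fin L → List ℕ}
    (hx : ∀ c, Fits (m c) (x c)) (hy : ∀ c, Fits (m c) (y c)) :
    H (K.satellite m fun c => x c ++ y c) = H (K.satellite m fun c => y c ++ x c) := by
  have key : ∀ s : Finset (Fin L), H (K.satellite m fun c => x c ++ y c) =
      H (K.satellite m fun c => if c ∈ s then y c ++ x c else x c ++ y c) := fun s => by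
    induction s using Finset.induction_on with
    | empty => simp
    | insert c s hc ih =>
      rw [ih]
      refine K.satellite_rotate hH (c := c) (x := x c) (y := y c) ?_ ?_ ?_ ?_
      · intro d
        split_ifs
        exacts [(hy d).append (hx d), (hx d).append (hy d)]
      · intro d hd
        simp [hd]
      · simp [hc]
      · simp
  simpa using key Finset.univ

theorem Link.birthLabels_word : birthLabels K.word = Finset.univ :=
  Finset.eq_univ_iff_forall.2 fun c => mem_birthLabels.2 (K.occurs c)

theorem Link.weight_satellite {κ : ZMod 2} {p : Fin L → List ℕ} (hp : ∀ c, Fits (m c) (p c)) :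
    weight 1 κ [] (K.satellite m p) =
      weight (fun c => (m c : ZMod 2)) κ [] K.word + κ * ∑ c, ((p c).length : ZMod 2) := by
  have h : weight 1 κ [] (K.satellite m p) = _ :=
    (runs_satelliteFrom (κ := κ) hp K.closed []).2
  rw [K.birthLabels_word] at h
  rw [h]
  simp

/-- For `κ = 0` the crossing terms, which are quadratic in the multiplicities, drop out. -/
theorem weight_linear (m : Fin L → ZMod 2) (S : Level (Fin L)) (w : Word (Fin L)) :
    weight m 0 S w = ∑ c, m c * weight (Pi.single c 1) 0 S w := by
  induction w generalizing S with
  | nil => simp [weight]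
  | cons e w ih =>
    have h1 : e.2.weight m 0 (S.drop e.1) =
        ∑ c, m c * e.2.weight (Pi.single c 1) 0 (S.drop e.1) := by
      have h2 : ∀ a, m a = ∑ c, m c * (Pi.single c 1 : Fin L → ZMod 2) a := fun a => by
        simp [Pi.single_apply]
      rcases e with ⟨i, ⟨c, o⟩ | _ | b⟩ <;> rcases S.drop i with _ | ⟨a, _ | ⟨a', l⟩⟩ <;>
        simp only [Piece.weight, zero_mul, mul_zero, Finset.sum_const_zero]
      all_goals split_ifs <;> simp [← h2]
    simp only [weight, h1, ih, mul_add, Finset.sum_add_distrib]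

/-- Modulo 2 the writhe is the number of self-crossings; the turning number occurs in both weights
and cancels. -/
theorem selfWritheFrom_cast (c : Fin L) {S T : Level (Fin L)} {w : Word (Fin L)}
    (h : run S w = some T) :
    ((selfWritheFrom c S w : ℤ) : ZMod 2) =
      weight (Pi.single c 1) 1 S w + weight (Pi.single c 1) 0 S w := by
  induction w generalizing S with
  | nil => simp [selfWritheFrom, weight]
  | cons e w ih =>
    obtain ⟨i, g⟩ := e
    obtain ⟨R, hR, hw⟩ := run_cons_eq_some.1 h
    obtain ⟨A, I, O, B, rfl, rfl, hg, rfl⟩ := exists_of_step hR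
    rw [weight_cons_of_acts _ _ hg _ _ rfl, weight_cons_of_acts _ _ hg _ _ rfl]
    unfold selfWritheFrom
    rw [hR, Option.getD_some, Int.cast_add, ih hw]
    have hneg : (-1 : ZMod 2) = 1 := by decide
    cases hg with
    | birth d o =>
      simp only [Piece.weight, Int.cast_zero]
      linear_combination -CharTwo.add_self_eq_zero
        (if o then (0 : ZMod 2) else (Pi.single c 1 : Fin L → ZMod 2) d)
    | death d o =>
      simp only [Piece.weight, Int.cast_zero]
      linear_combination -CharTwo.add_self_eq_zero
        (if o then (Pi.single c 1 : Fin L → ZMod 2) d else 0)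
    | cross b a a' =>
      have h1 : ((if a.1 = c ∧ a'.1 = c then (if b = (a.2 == a'.2) then 1 else -1) else 0 : ℤ) :
          ZMod 2) = (Pi.single c 1 : Fin L → ZMod 2) a.1 * (Pi.single c 1 : Fin L → ZMod 2) a'.1 := by
        by_cases h1 : a.1 = c <;> by_cases h2 : a'.1 = c <;> simp [h1, h2]
      simp only [Piece.weight, List.drop_left, List.cons_append, List.nil_append, h1]
      ring

/-- Framing 0 makes the number of self-crossings of each component even, so by Whitney's formula
each turning number is odd. -/
theorem Link.ZeroFramed.weight_word {K : Link L} (hK : K.ZeroFramed) (m : Fin L → ZMod 2) :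
    weight m 0 [] K.word = ∑ c, m c := by
  rw [weight_linear]
  refine Finset.sum_congr rfl fun c _ => ?_
  have h1 := selfWritheFrom_cast c K.closed
  rw [hK c, K.weight_word, Finset.sum_pi_single'] at h1
  have h2 : (1 : ZMod 2) = weight (Pi.single c 1) 0 [] K.word :=
    CharTwo.add_eq_zero.1 (by simpa using h1.symm)
  rw [← h2, mul_one]

theorem Link.substInvS_satellite {p : Fin L → List ℕ} (hp : ∀ c, Fits (m c) (p c)) :
    substInvS (homfly (K.satellite m p)) =
      (-1) ^ (∑ c, m c) * (∏ c, (-1) ^ (p c).length) * homfly (K.satellite m p) := by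
  rw [substInvS_homfly, K.weight_satellite hp, K.weight_word, one_mul, ← Nat.cast_sum,
    ← Nat.cast_sum, sgn_add, sgn_natCast, sgn_natCast, Finset.prod_pow_eq_pow_sum]

theorem Link.ZeroFramed.substNegV_satellite {K : Link L} (hK : K.ZeroFramed)
    {p : Fin L → List ℕ} (hp : ∀ c, Fits (m c) (p c)) :
    substNegV (homfly (K.satellite m p)) = (-1) ^ (∑ c, m c) * homfly (K.satellite m p) := by
  rw [substNegV_homfly, K.weight_satellite hp, hK.weight_word, zero_mul, add_zero,
    ← Nat.cast_sum, sgn_natCast]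

end Link

/-! ### The idempotents under transposition and inversion of `s` -/

section Idempotents

/-- Passes from sums over distinct words to sums over index tuples, allowing different indices to
yield the same word and coefficients to cancel. -/
theorem sum_piFinset_support {ι : Type} [Fintype ι] [DecidableEq ι] {X : ι → Type}
    (T : ∀ c, Finset (X c)) (w : ∀ c, X c → List ℕ) (k : ∀ c, X c → Coeff)
    (F : (ι → List ℕ) → Scalars) :
    ∑ p ∈ Fintype.piFinset fun c => (∑ x ∈ T c, Finsupp.single (w c x) (k c x)).support,
      LaurentPolynomial.C (∏ c, (∑ x ∈ T c, Finsupp.single (w c x) (k c x)) (p c)) * F p =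
    ∑ x ∈ Fintype.piFinset T,
      LaurentPolynomial.C (∏ c, k c (x c)) * F fun c => w c (x c) := by
  classical
  have hsub : ∀ c, (∑ x ∈ T c, Finsupp.single (w c x) (k c x)).support ⊆ (T c).image (w c) := by
    intro c
    refine Finsupp.support_finsetSum.trans (Finset.biUnion_subset.2 fun x hx => ?_)
    refine Finsupp.support_single_subset.trans ?_
    simpa using ⟨x, hx, rfl⟩
  rw [Finset.sum_subset (Fintype.piFinset_subset _ _ hsub)]
  · have h1 : ∀ p : ι → List ℕ,
        LaurentPolynomial.C (∏ c, (∑ x ∈ T c, Finsupp.single (w c x) (k c x)) (p c)) * F p =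
        ∑ x ∈ Fintype.piFinset T, if (fun c => w c (x c)) = p then
          LaurentPolynomial.C (∏ c, k c (x c)) * F p else 0 := fun p => by
      simp only [Finsupp.finsetSum_apply, Finsupp.single_apply]
      rw [Finset.prod_univ_sum, map_sum, Finset.sum_mul]
      refine Finset.sum_congr rfl fun x _ => ?_
      rw [Fintype.prod_ite_zero]
      simp only [funext_iff]
      split_ifs <;> simp
    simp only [h1]
    rw [Finset.sum_comm]
    refine Finset.sum_congr rfl fun x hx => ?_
    rw [Finset.sum_ite_eq, if_pos]
    exact Fintype.mem_piFinset.2 fun c =>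
      Finset.mem_image_of_mem _ (Fintype.mem_piFinset.1 hx c)
  · intro p _ hp
    simp only [Fintype.mem_piFinset, not_forall, Finsupp.notMem_support_iff] at hp
    obtain ⟨c, hc⟩ := hp
    rw [Finset.prod_eq_zero (Finset.mem_univ c) hc, map_zero, zero_mul]

/-- The pairs of a row permutation and a column permutation. -/
def youngPairs (A : YoungDiagram) :
    Finset (Equiv.Perm (Fin A.card) × Equiv.Perm (Fin A.card)) :=
  youngSubgroup A.rowLens A.card ×ˢ youngSubgroup A.transpose.rowLens A.card

/-- The braid words in the idempotent of `A`. -/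
def youngWord (A : YoungDiagram) (x : Equiv.Perm (Fin A.card) × Equiv.Perm (Fin A.card)) :
    List ℕ :=
  permWord x.1 ++ readingWord A ++ permWord x.2 ++ (readingWord A).reverse

/-- The coefficients in the idempotent of `A`. -/
noncomputable def youngCoeff (A : YoungDiagram)
    (x : Equiv.Perm (Fin A.card) × Equiv.Perm (Fin A.card)) : Coeff :=
  Ring.inverse (hookProduct A) * ((s ^ (-((permWord x.1).length : ℤ)) : Coeffˣ) : Coeff) *
    (-(s : Coeff)) ^ (permWord x.2).length

/-- The braid words in the idempotent of the transposed diagram. -/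
def youngWordTranspose (A : YoungDiagram)
    (x : Equiv.Perm (Fin A.card) × Equiv.Perm (Fin A.card)) : List ℕ :=
  permWord x.2 ++ readingWord A.transpose ++ permWord x.1 ++ (readingWord A.transpose).reverse

/-- The coefficients in the idempotent of the transposed diagram. -/
noncomputable def youngCoeffTranspose (A : YoungDiagram)
    (x : Equiv.Perm (Fin A.card) × Equiv.Perm (Fin A.card)) : Coeff :=
  Ring.inverse (hookProduct A.transpose) *
    ((s ^ (-((permWord x.2).length : ℤ)) : Coeffˣ) : Coeff) *
    (-(s : Coeff)) ^ (permWord x.1).length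

theorem youngIdempotent_eq (A : YoungDiagram) :
    youngIdempotent A = ∑ x ∈ youngPairs A, Finsupp.single (youngWord A x) (youngCoeff A x) := by
  rw [youngPairs, Finset.sum_product]
  rfl

theorem youngIdempotent_transpose_eq (A : YoungDiagram) :
    youngIdempotent A.transpose =
      ∑ x ∈ youngPairs A, Finsupp.single (youngWordTranspose A x) (youngCoeffTranspose A x) := by
  rw [youngPairs, Finset.sum_product_right, youngIdempotent, card_transpose,
    YoungDiagram.transpose_transpose]
  rfl

theorem fits_youngWord (A : YoungDiagram)
    (x : Equiv.Perm (Fin A.card) × Equiv.Perm (Fin A.card)) : Fits A.card (youngWord A x) :=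
  (((fits_permWord _).append (fits_readingWord A)).append (fits_permWord _)).append
    (fits_readingWord A).reverse

theorem fits_youngWordTranspose (A : YoungDiagram)
    (x : Equiv.Perm (Fin A.card) × Equiv.Perm (Fin A.card)) :
    Fits A.card (youngWordTranspose A x) := by
  have h := fits_readingWord A.transpose
  rw [card_transpose] at h
  exact (((fits_permWord _).append h).append (fits_permWord _)).append h.reverse

theorem isUnit_bracket (k : ℕ) : IsUnit (bracket (k + 1)) := by
  have hs : algebraMap (Polynomial ℚ) Coeff Polynomial.X = (s : Coeff) := rfl
  have h : IsUnit ((s : Coeff) ^ (2 * (k + 1)) - 1) := by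
    have := isUnit_of_mem (Submonoid.subset_closure (Or.inr ⟨k, rfl⟩) :
      (Polynomial.X ^ (2 * (k + 1)) - 1 : Polynomial ℚ) ∈ denominators)
    simpa [hs] using this
  have e : bracket (k + 1) =
      -(((s ^ (-((k + 1 : ℕ) : ℤ)) : Coeffˣ) : Coeff) * ((s : Coeff) ^ (2 * (k + 1)) - 1)) := by
    have h1 : ((s ^ (-((k + 1 : ℕ) : ℤ)) : Coeffˣ) : Coeff) * (s : Coeff) ^ (2 * (k + 1)) =
        ((s ^ ((k + 1 : ℕ) : ℤ) : Coeffˣ) : Coeff) := by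
      rw [← Units.val_pow_eq_pow_val, ← Units.val_mul, ← zpow_natCast, ← zpow_add]
      congr 2
      push_cast
      ring
    rw [mul_sub, h1, bracket]
    ring
  rw [e]
  exact ((Units.isUnit _).mul h).neg

theorem map_ringInverse {R R' : Type*} [CommRing R] [CommRing R'] (φ : R →+* R') {x : R}
    (hx : IsUnit x) : φ (Ring.inverse x) = Ring.inverse (φ x) := by
  obtain ⟨u, rfl⟩ := hx
  have h : φ u = ((Units.map (φ : R →* R') u : R'ˣ) : R') := rfl
  rw [Ring.inverse_unit, h, Ring.inverse_unit]
  rfl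

/-- Hook lengths of cells are positive, so only invertible brackets occur. -/
theorem isUnit_hookProduct (A : YoungDiagram) : IsUnit (hookProduct A) := by
  rw [hookProduct, IsUnit.prod_iff]
  intro c hc
  have h1 := YoungDiagram.mem_iff_lt_rowLen.1 ((YoungDiagram.mem_cells c).1 hc)
  have h2 := YoungDiagram.mem_iff_lt_colLen.1 ((YoungDiagram.mem_cells c).1 hc)
  refine (Units.isUnit _).mul (IsUnit.mul ?_ (isUnit_ringInverse.2 (isUnit_bracket 0)))
  obtain ⟨k, hk⟩ : ∃ k, (A.rowLen c.1 - c.2) + (A.colLen c.2 - c.1) - 1 = k + 1 :=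
    ⟨(A.rowLen c.1 - c.2) + (A.colLen c.2 - c.1) - 2, by omega⟩
  rw [hk]
  exact isUnit_bracket k

/-- Transposition keeps hook lengths and negates contents, and inversion of `s` undoes the latter;
the signs of the two brackets cancel in each quotient. -/
theorem invertCoeff_hookProduct (A : YoungDiagram) :
    invertCoeff (hookProduct A.transpose) = hookProduct A := by
  rw [hookProduct, hookProduct, map_prod]
  refine Finset.prod_bij (fun c _ => c.swap) ?_ (fun c _ d _ h => Prod.swap_injective h) ?_ ?_
  · intro c hc
    simpa using hc
  · intro c hc
    exact ⟨c.swap, by simpa using hc, Prod.swap_swap c⟩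
  · intro c hc
    have hneg : Ring.inverse (-bracket 1) = -Ring.inverse (bracket 1) := by
      obtain ⟨u, hu⟩ := isUnit_bracket 0
      rw [zero_add] at hu
      rw [← hu, ← Units.val_neg, Ring.inverse_unit, Ring.inverse_unit, inv_neg, Units.val_neg]
    rw [map_mul, map_mul, invertCoeff_zpow, invertCoeff_bracket,
      map_ringInverse _ (isUnit_bracket 0), zero_add, invertCoeff_bracket, hneg, neg_mul_neg,
      YoungDiagram.rowLen_transpose, YoungDiagram.colLen_transpose, Prod.fst_swap, Prod.snd_swap,
      neg_sub, add_comm]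

/-- The reading word occurs twice, so the sign of the word length is that of the row and column
permutations alone. It moves the sign in `(-s)^ℓ` from the row factor to the column factor, while
inversion exchanges the powers `s^{-ℓ}` and `s^ℓ`. -/
theorem invertCoeff_youngCoeffTranspose (A : YoungDiagram)
    (x : Equiv.Perm (Fin A.card) × Equiv.Perm (Fin A.card)) :
    invertCoeff (youngCoeffTranspose A x) * (-1) ^ (youngWordTranspose A x).length =
      youngCoeff A x := by
  have hlen : (-1 : Coeff) ^ (youngWordTranspose A x).length =
      (-1) ^ (permWord x.2).length * (-1) ^ (permWord x.1).length := by
    simp only [youngWordTranspose, List.length_append, List.length_reverse, pow_add]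
    have h : (-1 : Coeff) ^ (readingWord A.transpose).length *
        (-1) ^ (readingWord A.transpose).length = 1 := by
      rw [← mul_pow]
      simp
    linear_combination (-1 : Coeff) ^ (permWord x.2).length * (-1) ^ (permWord x.1).length * h
  have h1 : (s : Coeff) ^ (permWord x.2).length =
      ((s ^ ((permWord x.2).length : ℤ) : Coeffˣ) : Coeff) := by simp
  have h2 : ((s⁻¹ : Coeffˣ) : Coeff) ^ (permWord x.1).length =
      ((s ^ (-((permWord x.1).length : ℤ)) : Coeffˣ) : Coeff) := by
    rw [zpow_neg, ← inv_zpow]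
    simp
  have h3 : ((-1 : Coeff) ^ (permWord x.1).length) * (-1) ^ (permWord x.1).length = 1 := by
    rw [← mul_pow]
    simp
  rw [youngCoeff, youngCoeffTranspose, hlen, map_mul, map_mul, map_ringInverse _
    (isUnit_hookProduct _), invertCoeff_hookProduct, invertCoeff_zpow, neg_neg, map_pow, map_neg,
    invertCoeff_s, neg_pow, h2, neg_pow (s : Coeff), h1]
  linear_combination Ring.inverse (hookProduct A) *
    ((s ^ ((permWord x.2).length : ℤ) : Coeffˣ) : Coeff) *
    ((s ^ (-((permWord x.1).length : ℤ)) : Coeffˣ) : Coeff) * (-1) ^ (permWord x.2).length * h3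

end Idempotents

/-! ### Symmetries of the quantum invariants -/

variable {L : ℕ} (K : Link L) (A : Fin L → YoungDiagram)

/-- Replacing the reading words of the transpose by reverses of the original ones leaves the same
four factors in cyclically shifted order; rotating each component by two factors finishes. -/
theorem homfly_youngWordTranspose
    (x : ∀ c, Equiv.Perm (Fin (A c).card) × Equiv.Perm (Fin (A c).card)) :
    homfly (K.satellite (fun c => (A c).card) fun c => youngWordTranspose (A c) (x c)) =
      homfly (K.satellite (fun c => (A c).card) fun c => youngWord (A c) (x c)) := by
  by_cases hu : ∃! H : Diagram → Scalars, IsFramedHomfly H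
  · have hH := isFramedHomfly_homfly hu
    have hR : ∀ c, BraidEq homfly (readingWord (A c).transpose) (readingWord (A c)).reverse :=
      fun c => braidEq_readingWord _ hH
    have hR' : ∀ c, BraidEq homfly (readingWord (A c).transpose).reverse (readingWord (A c)) :=
      fun c => by
        have h := braidEq_readingWord (A c).transpose hH
        rw [YoungDiagram.transpose_transpose] at h
        exact h.symm
    have h1 := K.satellite_congr (m := fun c => (A c).card) fun c =>
      (((BraidEq.refl (permWord (x c).2)).append (hR c)).append
        (BraidEq.refl (permWord (x c).1))).append (hR' c)
    have h2 := K.satellite_rotate_all hH (m := fun c => (A c).card)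
      (x := fun c => permWord (x c).2 ++ (readingWord (A c)).reverse)
      (y := fun c => permWord (x c).1 ++ readingWord (A c))
      (fun c => (fits_permWord _).append (fits_readingWord _).reverse)
      (fun c => (fits_permWord _).append (fits_readingWord _))
    simp only [← List.append_assoc] at h2
    exact h1.trans h2
  · rw [homfly_eq_zero hu, homfly_eq_zero hu]

theorem quantumInvariant_eq :
    quantumInvariant K A = ∑ x ∈ Fintype.piFinset fun c => youngPairs (A c),
      LaurentPolynomial.C (∏ c, youngCoeff (A c) (x c)) *
        homfly (K.satellite (fun c => (A c).card) fun c => youngWord (A c) (x c)) := by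
  rw [quantumInvariant]
  simp only [youngIdempotent_eq]
  exact sum_piFinset_support _ _ _ fun p => homfly (K.satellite (fun c => (A c).card) p)

theorem quantumInvariant_transpose_eq :
    quantumInvariant K (fun c => (A c).transpose) =
      ∑ x ∈ Fintype.piFinset fun c => youngPairs (A c),
        LaurentPolynomial.C (∏ c, youngCoeffTranspose (A c) (x c)) *
          homfly (K.satellite (fun c => (A c).card) fun c => youngWordTranspose (A c) (x c)) := by
  rw [quantumInvariant]
  simp only [youngIdempotent_transpose_eq, card_transpose]
  exact sum_piFinset_support _ _ _ fun p => homfly (K.satellite (fun c => (A c).card) p)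

theorem substInvS_quantumInvariant_transpose :
    substInvS (quantumInvariant K fun c => (A c).transpose) =
      (-1) ^ (∑ c, (A c).card) * quantumInvariant K A := by
  rw [quantumInvariant_transpose_eq, quantumInvariant_eq, map_sum, Finset.mul_sum]
  refine Finset.sum_congr rfl fun x _ => ?_
  rw [map_mul, substInvS_C, K.substInvS_satellite fun c => fits_youngWordTranspose (A c) (x c),
    homfly_youngWordTranspose, map_prod]
  have h : ∏ c, youngCoeff (A c) (x c) = (∏ c, invertCoeff (youngCoeffTranspose (A c) (x c))) *
      ∏ c, (-1) ^ (youngWordTranspose (A c) (x c)).length := by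
    rw [← Finset.prod_mul_distrib]
    exact Finset.prod_congr rfl fun c _ => (invertCoeff_youngCoeffTranspose _ _).symm
  have h' : LaurentPolynomial.C (R := Coeff)
      (∏ c, (-1) ^ (youngWordTranspose (A c) (x c)).length) =
      ∏ c, (-1) ^ (youngWordTranspose (A c) (x c)).length := by
    simp only [map_prod, map_pow, map_neg, map_one]
  rw [h, map_mul, h']
  ring

variable {K}

theorem Link.ZeroFramed.substNegV_quantumInvariant (hK : K.ZeroFramed) :
    substNegV (quantumInvariant K A) = (-1) ^ (∑ c, (A c).card) * quantumInvariant K A := by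
  rw [quantumInvariant_eq, map_sum, Finset.mul_sum]
  refine Finset.sum_congr rfl fun x _ => ?_
  rw [map_mul, substNegV_C, hK.substNegV_satellite fun c => fits_youngWord (A c) (x c)]
  ring

theorem sum_rowLens (μ : YoungDiagram) : μ.rowLens.sum = μ.card := by
  rw [← length_rowReading, rowReading, List.length_flatMap]
  simp [YoungDiagram.rowLens]

theorem character_eq_zero {A μ : YoungDiagram} (h : A.card ≠ μ.card) : character A μ = 0 := by
  rw [character, dif_neg]
  rintro ⟨g, hg⟩
  have h1 := g.partition.parts_sum
  rw [hg, Multiset.sum_coe, sum_rowLens, Fintype.card_coe] at h1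
  exact h h1.symm

theorem Link.ZeroFramed.substNegV_reformulatedInvariant (hK : K.ZeroFramed)
    (μ : Fin L → YoungDiagram) :
    substNegV (reformulatedInvariant K μ) =
      (-1) ^ (∑ c, (μ c).card) * reformulatedInvariant K μ := by
  rw [reformulatedInvariant]
  -- The symmetry is linear and holds for 0, so it may be checked on each term. Terms with a size
  -- different from that of `μ` vanish; for the others the sign depends on `μ` only.
  refine finsum_induction
    (fun z : Scalars => substNegV z = (-1) ^ (∑ c, (μ c).card) * z) ?_ ?_ fun A => ?_
  · rw [map_zero, mul_zero]
  · intro y z hy hz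
    rw [map_add, hy, hz, mul_add]
  · by_cases hA : ∀ c, (A c).card = (μ c).card
    · rw [map_mul, RingHom.map_rat_algebraMap, hK.substNegV_quantumInvariant]
      simp only [hA]
      ring
    · obtain ⟨c, hc⟩ := not_forall.1 hA
      rw [Finset.prod_eq_zero (Finset.mem_univ c) (character_eq_zero hc), map_zero, zero_mul,
        map_zero, mul_zero]

end Homfly

theorem mainTheorem3 :
    (∀ D : Homfly.Diagram, Homfly.Closed D →
      (∃ P, Homfly.homfly D = Homfly.inclT P) ∨
        (∃ P, Homfly.homfly D = Homfly.v 1 * Homfly.inclT P)) ∧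
    (∀ (L : ℕ) (K : Homfly.Link L),
      (∀ A : Fin L → YoungDiagram,
        Homfly.substInvS (Homfly.quantumInvariant K fun c => (A c).transpose) =
          (-1) ^ (∑ c, (A c).card) * Homfly.quantumInvariant K A) ∧
      (K.ZeroFramed →
        (∀ A : Fin L → YoungDiagram,
          Homfly.substNegV (Homfly.quantumInvariant K A) =
            (-1) ^ (∑ c, (A c).card) * Homfly.quantumInvariant K A) ∧
        (∀ μ : Fin L → YoungDiagram, ∃ P,
          Homfly.v (-((∑ c, (μ c).card : ℕ) : ℤ)) * Homfly.reformulatedInvariant K μ =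
            Homfly.inclT P) ∧
        (∀ A : Fin L → YoungDiagram,
          Homfly.substInvS (Homfly.substNegV (Homfly.quantumInvariant K fun c => (A c).transpose)) =
            Homfly.quantumInvariant K A))) := by
  refine ⟨fun D _ => Homfly.homfly_mem D, fun L K =>
    ⟨Homfly.substInvS_quantumInvariant_transpose K, fun hK =>
      ⟨fun A => hK.substNegV_quantumInvariant A, fun μ => ?_, fun A => ?_⟩⟩⟩
  · refine Homfly.exists_inclT_of_substNegV ?_
    rw [hK.substNegV_reformulatedInvariant, Int.cast_natCast, Homfly.sgn_natCast]
  -- Both substitutions contribute the same sign, so the signs cancel.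
  · rw [hK.substNegV_quantumInvariant, map_mul, Homfly.substInvS_quantumInvariant_transpose,
      map_pow, map_neg, map_one]
    simp only [Homfly.card_transpose]
    rw [← mul_assoc, ← mul_pow, neg_mul_neg, one_mul, one_pow, one_mul]
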